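/- Let $L\ge 1$ and $E\ge 0$ be integers. Consider loop momenta $\ell_1,\dots,\ell_L$ and external momenta $p_1,\dots,p_E$, write $(q_1,\dots,q_M)=(\ell_1,\dots,\ell_L,p_1,\dots,p_E)$ with $M=L+E$, and let $\Theta$ be the set of unordered pairs $\{i,j\}$ with $1\le i\le L$ and $1\le j\le M$. The scalar products $s_{\{i,j\}}=q_i\cdot q_j$ with $\{i,j\}\in\Theta$ are treated as independent variables. The scalar products of external momenta are complex numbers, which form a symmetric matrix $G=(p_i\cdot p_j)_{i,j}$ with $\det G\neq 0$. Let $$D_a=\sum_{\{i,j\}\in\Theta}\mathcal A_a^{\{i,j\}}s_{\{i,j\}}+\lambda_a,\qquad 1\le a\le N,$$ be denominators with complex coefficients such that $N=|\Theta|$ and the $N\times N$ matrix $\mathcal A$ is invertible (a complete family, including irreducible scalar products). Decompose $$\sum_{a=1}^N x_aD_a=-\sum_{i,j=1}^L\Lambda_{ij}(\ell_i\cdot\ell_j)+\sum_{i=1}^L 2(Q_i\cdot\ell_i)+J$$ with $\Lambda$ symmetric, $Q_i$ linear combinations of the $p_r$, and $J$ free of loop momenta. Let $\mathcal U=\det\Lambda$,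 $\mathcal F=\mathcal U\,(Q^{\intercal}\Lambda^{-1}Q+J)$, and let $\mathcal G=\mathcal U+\mathcal F\in\mathbb C[x_1,\dots,x_N]$ be the Lee–Pomeransky polynomial. The Baikov polynomial $\mathcal P\in\mathbb C[y_1,\dots,y_N]$ is the unique polynomial with $\mathcal P(D_1,\dots,D_N)=\det(q_i\cdot q_j)_{1\le i,j\le M}$. The Bernstein–Sato polynomial of a non-constant $f\in\mathbb C[x_1,\dots,x_N]$ is the monic polynomial $b(s)\in\mathbb C[s]$ of smallest degree for which there is an operator $P(s)\in A^N[s]$ ($A^N$ the Weyl algebra) with $P(s)f^{s+1}=b(s)f^s$ in $\mathbb C[s,x,1/f]\cdot f^s$. If $\deg\mathcal P\le L+1$, then the Bernstein–Sato polynomial $b(s)$ of $\mathcal G$ (exists, is unique and) divides $$(s+1)\prod_{j=2}^{L+1}\Bigl(s+\frac{E+j}{2}\Bigr).$$ In particular, $s+1$ divides $b(s)$, and all roots of $b(s)/(s+1)$ are simple and lie in $\tfrac12\mathbb Z$. Moreover, the hypothesis $\deg\mathcal P\le L+1$ holds automatically if $E=1$ (propagator graphs) or $L=1$ (one-loop graphs).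 -/

import Mathlib

/-!
Part 1: the Weyl algebra, the module `ℂ[s, x, 1/f] · f ^ s` and Bernstein-Sato polynomials.
-/

/-- The defining relations of the Weyl algebra; the generator `Sum.inl i` is the variable `x i`,
the generator `Sum.inr i` is the derivative `∂ i`. -/
inductive WeylRel (K : Type*) [CommRing K] (N : ℕ) :
    FreeAlgebra K (Fin N ⊕ Fin N) → FreeAlgebra K (Fin N ⊕ Fin N) → Prop
  | x_comm (i j : Fin N) : WeylRel K N
      (FreeAlgebra.ι K (Sum.inl i) * FreeAlgebra.ι K (Sum.inl j))
      (FreeAlgebra.ι K (Sum.inl j) * FreeAlgebra.ι K (Sum.inl i))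
  | d_comm (i j : Fin N) : WeylRel K N
      (FreeAlgebra.ι K (Sum.inr i) * FreeAlgebra.ι K (Sum.inr j))
      (FreeAlgebra.ι K (Sum.inr j) * FreeAlgebra.ι K (Sum.inr i))
  | d_x (i j : Fin N) : WeylRel K N
      (FreeAlgebra.ι K (Sum.inr i) * FreeAlgebra.ι K (Sum.inl j))
      (FreeAlgebra.ι K (Sum.inl j) * FreeAlgebra.ι K (Sum.inr i) + if i = j then 1 else 0)

/-- The Weyl algebra in `N` variables with coefficients in `K`. For `K = ℂ[s]` it is the algebra
`A^N[s]` of polynomial differential operators that depend polynomially on the central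
parameter `s`. -/
abbrev WeylAlgebra (K : Type*) [CommRing K] (N : ℕ) : Type _ := RingQuot (WeylRel K N)

namespace BernsteinSato

open Polynomial

section LocDeriv

variable {K R S : Type*} [CommRing K] [CommRing R] [CommRing S] [Algebra K R] [Algebra R S]
  [Algebra K S] [IsScalarTower K R S]

/-- The ring homomorphism `g ↦ g + d(g) ε` from `R` to the dual numbers over `S`. -/
noncomputable def dualHom (S : Type*) [CommRing S] [Algebra R S] (d : Derivation K R R) :
    R →+* TrivSqZeroExt S S where
  toFun g := TrivSqZeroExt.inl (algebraMap R S g) + TrivSqZeroExt.inr (algebraMap R S (d g))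
  map_one' := by ext <;> simp
  map_zero' := by ext <;> simp
  map_add' a b := by ext <;> simp [-DualNumber.inr_eq_smul_eps]
  map_mul' a b := by ext <;> simp [-DualNumber.inr_eq_smul_eps, mul_comm]

theorem isUnit_dualHom {K R S : Type*} [CommRing K] [CommRing R] [CommRing S] [Algebra K R]
    [Algebra R S] (d : Derivation K R R) (f : R) [IsLocalization.Away f S] :
    IsUnit (dualHom S d f) := by
  rw [TrivSqZeroExt.isUnit_iff_isUnit_fst]
  simpa [dualHom] using IsLocalization.Away.algebraMap_isUnit (S := S) f

/-- The extension of `dualHom` to the localization `S = R[1/f]`. -/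
noncomputable def dualLift (S : Type*) [CommRing S] [Algebra R S] (d : Derivation K R R) (f : R)
    [IsLocalization.Away f S] : S →+* TrivSqZeroExt S S :=
  IsLocalization.Away.lift f (g := dualHom S d) (isUnit_dualHom d f)

theorem dualLift_algebraMap {K R S : Type*} [CommRing K] [CommRing R] [CommRing S] [Algebra K R]
    [Algebra R S] (d : Derivation K R R) (f : R) [IsLocalization.Away f S] (g : R) :
    dualLift S d f (algebraMap R S g) = dualHom S d g :=
  IsLocalization.Away.lift_eq f _ g

theorem fst_dualLift {K R S : Type*} [CommRing K] [CommRing R] [CommRing S] [Algebra K R]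
    [Algebra R S] (d : Derivation K R R) (f : R) [IsLocalization.Away f S] (z : S) :
    (dualLift S d f z).fst = z := by
  have h : ((TrivSqZeroExt.fstHom S S S : TrivSqZeroExt S S →+* S).comp (dualLift S d f)) = RingHom.id S := by
    apply IsLocalization.ringHom_ext (Submonoid.powers f)
    ext g
    simp [dualLift_algebraMap, dualHom]
  exact RingHom.congr_fun h z

/-- The unique extension of a derivation `d` of `R` to the localization `S = R[1/f]`
(the quotient rule). -/
noncomputable def locDeriv (S : Type*) [CommRing S] [Algebra R S] [Algebra K S]
    [IsScalarTower K R S] (d : Derivation K R R) (f : R) [IsLocalization.Away f S] :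
    Derivation K S S :=
  Derivation.mk'
    { toFun := fun z => (dualLift S d f z).snd
      map_add' := fun a b => by simp
      map_smul' := fun c a => by
        have h : dualLift S d f (algebraMap K S c) = TrivSqZeroExt.inl (algebraMap K S c) := by
          rw [IsScalarTower.algebraMap_apply K R S, dualLift_algebraMap]
          ext <;> simp [dualHom]
        simp [Algebra.smul_def, h] }
    (fun a b => by simp [fst_dualLift, mul_comm])

theorem locDeriv_algebraMap (d : Derivation K R R) (f : R) [IsLocalization.Away f S] (g : R) :
    locDeriv S d f (algebraMap R S g) = algebraMap R S (d g) := by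
  change (dualLift S d f (algebraMap R S g)).snd = _
  rw [dualLift_algebraMap]
  simp [dualHom, -DualNumber.inr_eq_smul_eps]

/-- Derivations of `R[1/f]` that agree on `R` are equal. -/
theorem derivation_ext {K R S : Type*} [CommRing K] [CommRing R] [CommRing S] [Algebra R S]
    [Algebra K S] (f : R) [IsLocalization.Away f S] (D₁ D₂ : Derivation K S S)
    (h : ∀ g : R, D₁ (algebraMap R S g) = D₂ (algebraMap R S g)) : D₁ = D₂ := by
  ext z
  obtain ⟨⟨g, ⟨_, k, rfl⟩⟩, hz⟩ := IsLocalization.surj (Submonoid.powers f) z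
  have hu : IsUnit (algebraMap R S (f ^ k)) :=
    IsLocalization.map_units S (⟨f ^ k, k, rfl⟩ : Submonoid.powers f)
  have h₁ := congrArg D₁ hz
  have h₂ := congrArg D₂ hz
  simp only [Derivation.leibniz, smul_eq_mul] at h₁ h₂
  rw [h, h g, ← h₂] at h₁
  exact hu.mul_left_cancel (add_left_cancel h₁)

end LocDeriv

/-- The module `ℂ[s, x, 1/f] · f ^ s`: the element `g · f ^ s` is represented by its
coefficient `g`. -/
abbrev PowModule {N : ℕ} (f : MvPolynomial (Fin N) ℂ) : Type :=
  Localization.Away (MvPolynomial.map (Polynomial.C : ℂ →+* ℂ[X]) f)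

/-- The coefficient `g` of `g · f ^ s`, for a polynomial `g` in `ℂ[s, x]`. -/
noncomputable abbrev toPow {N : ℕ} (f : MvPolynomial (Fin N) ℂ) :
    MvPolynomial (Fin N) ℂ[X] →+* PowModule f :=
  algebraMap _ _

/-- The polynomial `f` as an element of `ℂ[s, x, 1/f]`. -/
noncomputable def base {N : ℕ} (f : MvPolynomial (Fin N) ℂ) : PowModule f :=
  toPow f (MvPolynomial.map Polynomial.C f)

/-- The element `1/f` of `ℂ[s, x, 1/f]`. -/
noncomputable def invBase {N : ℕ} (f : MvPolynomial (Fin N) ℂ) : PowModule f :=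
  IsLocalization.Away.invSelf (MvPolynomial.map (Polynomial.C : ℂ →+* ℂ[X]) f)

theorem base_mul_invBase {N : ℕ} (f : MvPolynomial (Fin N) ℂ) : base f * invBase f = 1 :=
  IsLocalization.Away.mul_invSelf _

/-- The partial derivative with respect to `x i` on `ℂ[s, x, 1/f]`. -/
noncomputable def partialDeriv {N : ℕ} (f : MvPolynomial (Fin N) ℂ) (i : Fin N) :
    Derivation ℂ[X] (PowModule f) (PowModule f) :=
  locDeriv (PowModule f) (MvPolynomial.pderiv i) (MvPolynomial.map Polynomial.C f)

/-- The logarithmic derivative `(∂ f / ∂ x i) / f`. -/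
noncomputable def logDeriv {N : ℕ} (f : MvPolynomial (Fin N) ℂ) (i : Fin N) : PowModule f :=
  partialDeriv f i (base f) * invBase f

/-- The action of `x i`, that is `x i · (g · f ^ s) = (x i * g) · f ^ s`. -/
noncomputable def xAct {N : ℕ} (f : MvPolynomial (Fin N) ℂ) (i : Fin N) :
    Module.End ℂ[X] (PowModule f) :=
  LinearMap.mulLeft ℂ[X] (toPow f (MvPolynomial.X i))

/-- The action of `∂ i`, that is
`∂ i · (g · f ^ s) = (∂ g / ∂ x i + s * g * (∂ f / ∂ x i) / f) · f ^ s`. -/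
noncomputable def dAct {N : ℕ} (f : MvPolynomial (Fin N) ℂ) (i : Fin N) :
    Module.End ℂ[X] (PowModule f) :=
  (partialDeriv f i).toLinearMap + (Polynomial.X : ℂ[X]) • LinearMap.mulLeft ℂ[X] (logDeriv f i)

theorem dAct_apply {N : ℕ} (f : MvPolynomial (Fin N) ℂ) (i : Fin N) (g : PowModule f) :
    dAct f i g = partialDeriv f i g + (Polynomial.X : ℂ[X]) • (logDeriv f i * g) := rfl

theorem partialDeriv_comm {N : ℕ} (f : MvPolynomial (Fin N) ℂ) (i j : Fin N) (g : PowModule f) :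
    partialDeriv f i (partialDeriv f j g) = partialDeriv f j (partialDeriv f i g) := by
  have h : ⁅partialDeriv f i, partialDeriv f j⁆ = 0 := by
    apply derivation_ext (MvPolynomial.map (Polynomial.C : ℂ →+* ℂ[X]) f)
    intro p
    have hp : ⁅MvPolynomial.pderiv (R := ℂ[X]) i, MvPolynomial.pderiv (R := ℂ[X]) j⁆ = 0 := by
      apply MvPolynomial.derivation_ext
      intro k
      simp only [Derivation.commutator_apply, MvPolynomial.pderiv_X, Pi.single_apply]
      split_ifs <;> simp
    have hp' := congrArg (fun D : Derivation ℂ[X] (MvPolynomial (Fin N) ℂ[X])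
      (MvPolynomial (Fin N) ℂ[X]) => toPow f (D p)) hp
    simpa [Derivation.commutator_apply, partialDeriv, locDeriv_algebraMap] using hp'
  have h' := congrArg (fun D : Derivation ℂ[X] (PowModule f) (PowModule f) => D g) h
  simpa [Derivation.commutator_apply, sub_eq_zero] using h'

theorem partialDeriv_invBase {N : ℕ} (f : MvPolynomial (Fin N) ℂ) (i : Fin N) :
    partialDeriv f i (invBase f) = - (invBase f ^ 2 * partialDeriv f i (base f)) := by
  have h := congrArg (partialDeriv f i) (base_mul_invBase f)
  simp only [Derivation.leibniz, smul_eq_mul, Derivation.map_one_eq_zero] at h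
  linear_combination (invBase f) * h - partialDeriv f i (invBase f) * base_mul_invBase f

/-- `∂ i` maps `(p / f ^ k) · f ^ s` to
`((f * ∂ p / ∂ x i + (s - k) * p * ∂ f / ∂ x i) / f ^ (k + 1)) · f ^ s`. -/
theorem dAct_frac {N : ℕ} (f : MvPolynomial (Fin N) ℂ) (i : Fin N)
    (p : MvPolynomial (Fin N) (Polynomial ℂ)) (k : ℕ) :
    dAct f i (toPow f p * invBase f ^ k) =
      (base f * toPow f (MvPolynomial.pderiv i p) + (Polynomial.X - (k : Polynomial ℂ)) •
        (toPow f p * toPow f (MvPolynomial.map Polynomial.C (MvPolynomial.pderiv i f))))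
        * invBase f ^ (k + 1) := by
  have hb : partialDeriv f i (base f) =
      toPow f (MvPolynomial.map Polynomial.C (MvPolynomial.pderiv i f)) := by
    simp [partialDeriv, base, locDeriv_algebraMap, MvPolynomial.pderiv_map]
  have hp : partialDeriv f i (toPow f p) = toPow f (MvPolynomial.pderiv i p) := by
    simp [partialDeriv, locDeriv_algebraMap]
  rw [dAct_apply, Derivation.leibniz, Derivation.leibniz_pow, partialDeriv_invBase, logDeriv, hb, hp]
  simp only [smul_eq_mul, Algebra.smul_def, map_sub, map_natCast, nsmul_eq_mul]
  have := base_mul_invBase f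
  cases k with
  | zero => 
    simp
    linear_combination (-toPow f (MvPolynomial.pderiv i p)) * this
  | succ n => 
    simp
    linear_combination (-toPow f (MvPolynomial.pderiv i p)*invBase f^(n+1)) * this

theorem dAct_comm {N : ℕ} (f : MvPolynomial (Fin N) ℂ) (i j : Fin N) :
    dAct f i * dAct f j = dAct f j * dAct f i := by
  ext g
  have hl : partialDeriv f i (logDeriv f j) = partialDeriv f j (logDeriv f i) := by
    simp only [logDeriv, Derivation.leibniz, smul_eq_mul, partialDeriv_invBase,
      partialDeriv_comm f i j (base f)]
    ring
  simp only [Module.End.mul_apply, dAct_apply, map_add, Derivation.map_smul, Derivation.leibniz,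
    smul_eq_mul, hl, partialDeriv_comm f i j g, smul_add, mul_smul_comm]
  rw [mul_left_comm (logDeriv f i) (logDeriv f j) g, mul_comm g]
  abel

/-- The images of the generators of the Weyl algebra. -/
noncomputable def genAct {N : ℕ} (f : MvPolynomial (Fin N) ℂ) :
    Fin N ⊕ Fin N → Module.End ℂ[X] (PowModule f) :=
  Sum.elim (xAct f) (dAct f)

/-- The action of the algebra `A^N[s]` on the module `ℂ[s, x, 1/f] · f ^ s`. -/
noncomputable def act {N : ℕ} (f : MvPolynomial (Fin N) ℂ) :
    WeylAlgebra ℂ[X] N →ₐ[ℂ[X]] Module.End ℂ[X] (PowModule f) :=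
  RingQuot.liftAlgHom ℂ[X] ⟨FreeAlgebra.lift ℂ[X] (genAct f), by
    intro a b hab
    induction hab with
    | x_comm i j =>
      ext g
      simp [genAct, xAct, mul_left_comm]
    | d_comm i j => simpa [genAct] using dAct_comm f i j
    | d_x i j =>
      ext g
      have hX : partialDeriv f i (toPow f (MvPolynomial.X j)) = if i = j then 1 else 0 := by
        simp only [partialDeriv, locDeriv_algebraMap, MvPolynomial.pderiv_X, Pi.single_apply]
        split_ifs <;> simp_all
      split_ifs with hij
      · simp only [hij, if_true] at hX
        simp [genAct, xAct, dAct_apply, hX, hij, mul_add, mul_left_comm (logDeriv f j)]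
        ring
      · simp only [hij, if_false] at hX
        simp [genAct, xAct, dAct_apply, hX, mul_add, mul_left_comm (logDeriv f i)]⟩

/-- `P` is a Bernstein-Sato operator of `f` for the polynomial `b`: the functional equation
`P(s) f ^ (s + 1) = b(s) f ^ s` holds, where `f ^ (s + 1) = f · f ^ s`. -/
def FunctionalEquation {N : ℕ} (f : MvPolynomial (Fin N) ℂ) (P : WeylAlgebra ℂ[X] N)
    (b : ℂ[X]) : Prop :=
  act f P (base f) = b • (1 : PowModule f)

/-- `b` is the Bernstein-Sato polynomial of `f`: the monic polynomial of smallest degree for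
which the functional equation has a solution. -/
structure IsBernsteinSatoPolynomial {N : ℕ} (f : MvPolynomial (Fin N) ℂ) (b : ℂ[X]) : Prop where
  monic : b.Monic
  exists_operator : ∃ P : WeylAlgebra ℂ[X] N, FunctionalEquation f P b
  minimal : ∀ c : ℂ[X], c.Monic → (∃ P : WeylAlgebra ℂ[X] N, FunctionalEquation f P c) →
    b.natDegree ≤ c.natDegree

end BernsteinSato

/-!
Part 2: integral families, Lee-Pomeransky polynomials and Baikov polynomials.
-/

/-- The unordered pairs of momenta that contain a loop momentum. The momenta are labelled by
`Fin L ⊕ Fin E`: `Sum.inl i` is the loop momentum `ℓ i`, `Sum.inr r` the external momentum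
`p r`. -/
abbrev LoopPair (L E : ℕ) : Type :=
  {t : Sym2 (Fin L ⊕ Fin E) // ∃ i : Fin L, Sum.inl i ∈ t}

/-- The pair that consists of the loop momentum `ℓ i` and any momentum `q`. -/
def LoopPair.mk {L E : ℕ} (i : Fin L) (q : Fin L ⊕ Fin E) : LoopPair L E :=
  ⟨s(Sum.inl i, q), i, Sym2.mem_mk_left _ _⟩

/-- An integral family with `L` loop momenta, `E` external momenta and `N` denominators
`D a = ∑ t, coeff a t * s t + const a`, where `s t` is the scalar product of the two momenta of
the pair `t`. The kinematics enters through the Gram matrix of the external momenta. -/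
structure IntegralFamily (L E N : ℕ) where
  gram : Matrix (Fin E) (Fin E) ℂ
  gram_symm : gram.IsSymm
  coeff : Matrix (Fin N) (LoopPair L E) ℂ
  const : Fin N → ℂ

namespace IntegralFamily

open MvPolynomial

variable {L E N : ℕ} (F : IntegralFamily L E N)

/-- A complete family: the coefficient matrix is invertible, so that in particular `N` is the
number of loop-momentum dependent scalar products. -/
def IsComplete : Prop :=
  ∃ B : Matrix (LoopPair L E) (Fin N) ℂ, F.coeff * B = 1 ∧ B * F.coeff = 1

/-- The symmetric `L × L` matrix of (minus) the quadratic part of `∑ a, x a * D a` in the loop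
momenta. -/
noncomputable def loopMatrix : Matrix (Fin L) (Fin L) (MvPolynomial (Fin N) ℂ) :=
  fun i j => - ∑ a, C ((if i = j then 1 else 1 / 2) * F.coeff a (.mk i (.inl j))) * X a

/-- The linear part of `∑ a, x a * D a` is `∑ i, 2 * (Q i · ℓ i)` with the linear combination
`Q i = ∑ r, linearPart i r * p r` of external momenta. -/
noncomputable def linearPart : Matrix (Fin L) (Fin E) (MvPolynomial (Fin N) ℂ) :=
  fun i r => ∑ a, C (1 / 2 * F.coeff a (.mk i (.inr r))) * X a

/-- The scalar products `Q i · Q j`. -/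
noncomputable def linearGram : Matrix (Fin L) (Fin L) (MvPolynomial (Fin N) ℂ) :=
  F.linearPart * (F.gram.map C : Matrix _ _ (MvPolynomial (Fin N) ℂ)) * F.linearPart.transpose

/-- The part of `∑ a, x a * D a` that is constant in the loop momenta. -/
noncomputable def constPart : MvPolynomial (Fin N) ℂ := ∑ a, C (F.const a) * X a

/-- The polynomial `𝓤 = det Λ`. -/
noncomputable def symanzikU : MvPolynomial (Fin N) ℂ := F.loopMatrix.det

/-- The polynomial `𝓕 = 𝓤 * (Qᵀ Λ⁻¹ Q + J)`, where `𝓤 * Λ⁻¹` is the adjugate of `Λ`. -/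
noncomputable def symanzikF : MvPolynomial (Fin N) ℂ :=
  (∑ i, ∑ j, F.loopMatrix.adjugate i j * F.linearGram i j) + F.symanzikU * F.constPart

/-- The Lee-Pomeransky polynomial `𝓖 = 𝓤 + 𝓕`. -/
noncomputable def leePomeransky : MvPolynomial (Fin N) ℂ := F.symanzikU + F.symanzikF

/-- The scalar products of the momenta: an independent variable for each pair that contains a
loop momentum, and a number for a pair of external momenta. -/
noncomputable def scalarProduct :
    Matrix (Fin L ⊕ Fin E) (Fin L ⊕ Fin E) (MvPolynomial (LoopPair L E) ℂ)
  | .inl i, q => X (.mk i q)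
  | .inr r, .inl i => X (.mk i (.inr r))
  | .inr r, .inr t => C (F.gram r t)

/-- The denominators as polynomials in the loop-momentum dependent scalar products. -/
noncomputable def denominator (a : Fin N) : MvPolynomial (LoopPair L E) ℂ :=
  ∑ t, C (F.coeff a t) * X t + C (F.const a)

/-- A sum over pairs as a sum over ordered pairs; `{i, j}` with `i ≠ j` is met twice. -/
theorem sum_loopPair {M : Type*} [AddCommGroup M] [Module ℂ M] (h : LoopPair L E → M) :
    ∑ t, h t = (∑ i, ∑ j, (if i = j then 1 else 1/2 : ℂ) • h (.mk i (.inl j))) +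
      ∑ i, ∑ r, h (.mk i (.inr r)) := by
  let w : Fin L × (Fin L ⊕ Fin E) → ℂ :=
    fun p => Sum.elim (fun j => if p.1 = j then 1 else 1 / 2) (fun _ => 1) p.2
  let m : Fin L × (Fin L ⊕ Fin E) → LoopPair L E := fun p => .mk p.1 p.2
  have hw : ∀ t, ∑ p with m p = t, w p = 1 := by
    rintro ⟨t, i, ht⟩
    obtain ⟨q, rfl⟩ := ht
    rcases q with j | r
    · change ∑ p with m p = LoopPair.mk i (.inl j), w p = 1
      have : (Finset.univ.filter fun p => m p = LoopPair.mk i (.inl j)) =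
          {(i, .inl j), (j, .inl i)} := by
        ext ⟨k, q⟩
        simp [m, LoopPair.mk]
      rw [this]
      by_cases hij : i = j
      · subst hij
        simp [w]
      · rw [Finset.sum_pair (by simp [hij])]
        simp [w, hij, Ne.symm hij]
        norm_num
    · change ∑ p with m p = LoopPair.mk i (.inr r), w p = 1
      have : (Finset.univ.filter fun p => m p = LoopPair.mk i (.inr r)) =
          {(i, .inr r)} := by
        ext ⟨k, q⟩
        simp [m, LoopPair.mk]
      simp [this, w]
  have hs : ∑ p, w p • h (m p) = ∑ t, h t := by
    rw [← Finset.sum_fiberwise Finset.univ m]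
    refine Finset.sum_congr rfl fun t _ => ?_
    rw [Finset.sum_congr rfl (g := fun p => w p • h t)
      (fun p hp => by rw [(Finset.mem_filter.mp hp).2]), ← Finset.sum_smul, hw, one_smul]
  rw [← hs, Fintype.sum_prod_type]
  simp [Fintype.sum_sum_type, Finset.sum_add_distrib, w, m]

/-- The decomposition of `∑ a, x a * D a` into its quadratic, linear and constant parts in the
loop momenta. -/
theorem decomposition (x : Fin N → ℂ) : ∑ a, C (x a) * F.denominator a =
    - ∑ i, ∑ j, C (eval x (F.loopMatrix i j)) * F.scalarProduct (.inl i) (.inl j)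
    + ∑ i, 2 * ∑ r, C (eval x (F.linearPart i r)) * F.scalarProduct (.inl i) (.inr r)
    + C (eval x F.constPart) := by
  have h (a : Fin N) := sum_loopPair (fun t => C (F.coeff a t) * X t : LoopPair L E → MvPolynomial (LoopPair L E) ℂ)
  have h2 : (2 : MvPolynomial (LoopPair L E) ℂ) = C 2 := (map_ofNat C 2).symm
  simp only [denominator, h, scalarProduct, loopMatrix, linearPart, constPart, map_neg, map_sum, map_mul, eval_C, eval_X, neg_mul, Finset.sum_neg_distrib, neg_neg, mul_add, Finset.sum_add_distrib, Finset.sum_mul, Finset.mul_sum, smul_eq_C_mul, h2]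
  congr 1
  · congr 1
    · rw [Finset.sum_comm]; refine Finset.sum_congr rfl fun i _ => ?_
      rw [Finset.sum_comm]; refine Finset.sum_congr rfl fun j _ => ?_
      refine Finset.sum_congr rfl fun a _ => by ring
    · rw [Finset.sum_comm]; refine Finset.sum_congr rfl fun i _ => ?_
      rw [Finset.sum_comm]; refine Finset.sum_congr rfl fun j _ => ?_
      refine Finset.sum_congr rfl fun a _ => ?_
      have : (C 2 * C (1/2) : MvPolynomial (LoopPair L E) ℂ) = 1 := by rw [← C_mul]; norm_num
      linear_combination (- C (x a) * C (F.coeff a (.mk i (.inr j))) * X (LoopPair.mk i (.inr j))) * this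
  · refine Finset.sum_congr rfl fun a _ => by ring

/-- `P` is the Baikov polynomial: `P (D 1, …, D N)` is the Gram determinant of all momenta. -/
def IsBaikovPolynomial (P : MvPolynomial (Fin N) ℂ) : Prop :=
  aeval F.denominator P = F.scalarProduct.det

/-- A complete family has exactly one Baikov polynomial. -/
theorem existsUnique_isBaikovPolynomial (hF : F.IsComplete) :
    ∃! P : MvPolynomial (Fin N) ℂ, F.IsBaikovPolynomial P := by
  obtain ⟨B, hAB, hBA⟩ := hF
  let ψ : MvPolynomial (LoopPair L E) ℂ →ₐ[ℂ] MvPolynomial (Fin N) ℂ :=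
    aeval fun t => ∑ a, C (B t a) * (X a - C (F.const a))
  have h1 : (aeval F.denominator).comp ψ = AlgHom.id ℂ _ := by
    apply MvPolynomial.algHom_ext
    intro t
    have : ∀ u, ∑ a, B t a * F.coeff a u = if t = u then 1 else 0 := fun u => by
      rw [← Matrix.mul_apply, hBA, Matrix.one_apply]
    simp only [ψ, denominator, AlgHom.comp_apply, aeval_X, map_sum, map_mul, map_sub, aeval_C,
      MvPolynomial.algebraMap_eq, add_sub_cancel_right, Finset.mul_sum, AlgHom.id_apply]
    rw [Finset.sum_comm]
    simp only [← mul_assoc, ← C_mul, ← Finset.sum_mul, ← map_sum, this]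
    simp
  have h2 : ψ.comp (aeval F.denominator) = AlgHom.id ℂ _ := by
    apply MvPolynomial.algHom_ext
    intro a
    have : ∀ c, ∑ t, F.coeff a t * B t c = if a = c then 1 else 0 := fun c => by
      rw [← Matrix.mul_apply, hAB, Matrix.one_apply]
    simp only [ψ, denominator, AlgHom.comp_apply, aeval_X, map_add, map_sum, map_mul, aeval_C,
      MvPolynomial.algebraMap_eq, Finset.mul_sum, AlgHom.id_apply]
    rw [Finset.sum_comm]
    simp only [← mul_assoc, ← C_mul, ← Finset.sum_mul, ← map_sum, this]
    simp
  refine ⟨ψ F.scalarProduct.det, ?_, ?_⟩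
  · exact congrArg (fun φ => φ F.scalarProduct.det) h1
  · intro P hP
    have h := congrArg (fun φ => φ P) h2
    simp only [AlgHom.comp_apply, AlgHom.id_apply] at h
    rw [← h]
    exact congrArg ψ hP

end IntegralFamily

/-!
Since `𝓤 * y + 𝓕 = det Λ * z` with `z = y + J + Qᵀ Λ⁻¹ Q`, adding a variable `y` turns the
Lee-Pomeransky polynomial into a homogeneous polynomial of degree `L + 1`. On `ℂ[x, y, 1/𝓤]` the
derivations `σ i j` and `τ i r` dual to the scalar products `ℓᵢ · ℓⱼ` and `ℓᵢ · p_r`, together with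
`T = ∂/∂y`, yield the heat operators `b i j = T σ i j - ∑ g⁻¹ r s τ i r τ j s`, where `g` is the
Gram matrix of the external momenta. They act on the divided powers
`Ψ a m = (det Λ) ^ a * z ^ m / m!` almost as derivations of functions of `Λ⁻¹`, and as in Cayley's
identity `det b` maps `Ψ a (m + L)` to a multiple of `(det Λ)⁻¹ * Ψ a m`, with factor
`± ∏ (a + E / 2 + j / 2)` over `0 ≤ j < L`.

By a Schur complement, `y * det g * det b` is the symbol of the homogenized Baikov polynomial,
up to `y ^ L`. The bound on the degree is exactly what makes it possible to cancel `y ^ L`, so that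
`P(∂)`, homogenized in degree `L + 1`, maps `(𝓤 * y + 𝓕) ^ (n + 1)` to a multiple of
`(𝓤 * y + 𝓕) ^ n`. At `y = 1`, Euler's identity replaces `∂/∂y` by an operator in `x`, and since the
resulting identities are polynomial in `n` they hold with `s` in place of `n`. The factor `s + 1`
comes from `𝓖(0) = 0`: at `s = -1` the functional equation would otherwise write a nonzero constant
as a multiple of `𝓖`.
-/

section CommutingFamily

open MvPolynomial

variable {σ ρ R A : Type*} [CommRing R] [Ring A] [Algebra R A]

open scoped IsMulCommutative in
/-- Evaluation of a polynomial at a family of commuting elements of a noncommutative algebra. It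
factors through the commutative subalgebra that the family generates. -/
noncomputable def commAeval (T : σ → A) (hT : ∀ i j, Commute (T i) (T j)) :
    MvPolynomial σ R →ₐ[R] A :=
  haveI := Algebra.isMulCommutative_adjoin R (s := Set.range T)
    (by rintro _ ⟨i, rfl⟩ _ ⟨j, rfl⟩; exact hT i j)
  (Algebra.adjoin R (Set.range T)).val.comp
    (aeval (S₁ := Algebra.adjoin R (Set.range T))
      fun i => ⟨T i, Algebra.subset_adjoin ⟨i, rfl⟩⟩)

open scoped IsMulCommutative in
@[simp]
theorem commAeval_X (T : σ → A) (hT : ∀ i j, Commute (T i) (T j)) (i : σ) :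
    commAeval (R := R) T hT (X i) = T i := by
  simp [commAeval]

theorem commAeval_intertwines {V W : Type*} [AddCommGroup V] [Module R V] [AddCommGroup W]
    [Module R W] (φ : V →ₗ[R] W) {T : σ → Module.End R V} (hT : ∀ i j, Commute (T i) (T j))
    {T' : ρ → Module.End R W} (hT' : ∀ i j, Commute (T' i) (T' j)) (e : σ → ρ)
    (h : ∀ i v, φ (T i v) = T' (e i) (φ v)) (p : MvPolynomial σ R) (v : V) :
    φ (commAeval T hT p v) = commAeval T' hT' (rename e p) (φ v) := by
  induction p using MvPolynomial.induction_on generalizing v with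
  | C c =>
    simp only [← algebraMap_eq, AlgHom.commutes, Module.algebraMap_end_apply, map_smul]
  | add p q hp hq => simp only [map_add, LinearMap.add_apply, hp, hq]
  | mul_X p i hp => simp only [map_mul, commAeval_X, Module.End.mul_apply, hp, h, rename_X]

end CommutingFamily

section MatrixDerivation

open Matrix

variable {K R : Type*} [CommRing K] [CommRing R] [Algebra K R] (D : Derivation K R R)
variable {l m n : Type*}

theorem derivation_prod [DecidableEq n] (s : Finset n) (f : n → R) :
    D (∏ i ∈ s, f i) = ∑ i ∈ s, D (f i) * ∏ j ∈ s.erase i, f j := by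
  induction s using Finset.induction_on with
  | empty => simp
  | insert a s ha ih =>
    rw [Finset.prod_insert ha, Derivation.leibniz, ih, Finset.sum_insert ha,
      Finset.erase_insert ha, smul_eq_mul, smul_eq_mul, add_comm, Finset.mul_sum,
      mul_comm (D (f a))]
    congr 1
    refine Finset.sum_congr rfl fun i hi => ?_
    have hia : a ≠ i := fun h => ha (h ▸ hi)
    rw [Finset.erase_insert_of_ne hia, Finset.prod_insert (mt Finset.mem_of_mem_erase ha),
      mul_left_comm]

theorem derivation_det [Fintype n] [DecidableEq n] (A : Matrix n n R) :
    D A.det = ∑ i, (A.updateRow i fun j => D (A i j)).det := by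
  simp only [← det_transpose A, ← det_transpose (A.updateRow _ _), det_apply, map_sum]
  rw [Finset.sum_comm]
  refine Finset.sum_congr rfl fun τ _ => ?_
  rw [← Finset.smul_sum, Units.smul_def, Units.smul_def, map_zsmul, derivation_prod]
  congr 1
  refine Finset.sum_congr rfl fun i _ => ?_
  rw [← Finset.mul_prod_erase _ _ (Finset.mem_univ i)]
  congr 1
  · simp
  · refine Finset.prod_congr rfl fun j hj => ?_
    simp [updateRow_ne (Finset.ne_of_mem_erase hj)]

theorem map_derivation_mul [Fintype m] (A : Matrix l m R) (B : Matrix m n R) :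
    (A * B).map D = A.map D * B + A * B.map D := by
  ext i j
  simp only [map_apply, Matrix.add_apply, mul_apply, map_sum, Derivation.leibniz, smul_eq_mul,
    ← Finset.sum_add_distrib]
  exact Finset.sum_congr rfl fun k _ => by ring

variable [Fintype n]

theorem derivation_trace (A : Matrix n n R) : D A.trace = (A.map D).trace := by
  simp [trace]

variable [DecidableEq n]

theorem map_derivation_inv {A : Matrix n n R} (hA : IsUnit A.det) :
    A⁻¹.map D = -(A⁻¹ * A.map D * A⁻¹) := by
  have h : A⁻¹.map D * A + A⁻¹ * A.map D = 0 := by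
    rw [← map_derivation_mul, nonsing_inv_mul A hA]
    ext i j
    by_cases hij : i = j <;> simp [hij]
  rw [← mul_nonsing_inv_cancel_right A (A⁻¹.map D) hA, eq_neg_of_add_eq_zero_left h,
    Matrix.neg_mul]

theorem det_updateRow_eq_sum (A : Matrix n n R) (i : n) (v : n → R) :
    (A.updateRow i v).det = ∑ j, v j * (A.updateRow i (Pi.single j 1)).det := by
  rw [det_eq_sum_mul_adjugate_row _ i]
  simp only [updateRow_self, adjugate_apply, updateRow_idem]

theorem derivation_det_eq_mul_trace {A : Matrix n n R} (hA : IsUnit A.det) :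
    D A.det = A.det * (A⁻¹ * A.map D).trace := by
  have hadj : A.det • A⁻¹ = A.adjugate := by
    rw [inv_def, smul_smul, Ring.mul_inverse_cancel _ hA, one_smul]
  rw [← smul_eq_mul, ← trace_smul, ← Matrix.smul_mul, hadj, trace_mul_comm, derivation_det]
  refine Finset.sum_congr rfl fun i _ => ?_
  rw [det_updateRow_eq_sum, diag_apply, mul_apply]
  simp only [map_apply, adjugate_apply]

end MatrixDerivation

section Cayley

open Matrix

section Alternating

variable {R n : Type*} [CommRing R] [Fintype n]

theorem sum_sum_mul_eq_zero_of_alternating {Y : Matrix n n R} (hY : Y.IsSymm) (B : n → n → R)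
    (hB₀ : ∀ l, B l l = 0) (hB : ∀ l m, B l m = -B m l) : ∑ l, ∑ m, Y l m * B l m = 0 := by
  rw [← Fintype.sum_prod_type' fun l m => Y l m * B l m]
  refine Finset.sum_involution (fun p _ => p.swap) (fun p _ => ?_) (fun p _ hp hp' => hp ?_)
    (fun _ _ => Finset.mem_univ _) (fun p _ => p.swap_swap)
  · simp [hB p.2 p.1, hY.apply p.1 p.2]
  · obtain ⟨l, m⟩ := p
    obtain rfl : m = l := congrArg Prod.fst hp'
    simp [hB₀]

variable [DecidableEq n]

theorem det_updateRow_updateRow_swap (A : Matrix n n R) {i p : n} (hip : i ≠ p) (a b : n → R) :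
    ((A.updateRow i a).updateRow p b).det = -((A.updateRow i b).updateRow p a).det := by
  suffices h : (A.updateRow i a).updateRow p b =
      ((A.updateRow i b).updateRow p a).submatrix (Equiv.swap i p) id by
    rw [h, det_permute, Equiv.Perm.sign_swap hip]
    simp
  ext q
  rcases eq_or_ne q i with rfl | hqi
  · simp [updateRow_ne hip]
  rcases eq_or_ne q p with rfl | hqp
  · simp [updateRow_ne hip]
  · simp [updateRow_ne, hqi, hqp, Equiv.swap_apply_of_ne_of_ne]

theorem sum_det_updateRow_single_eq_zero (A : Matrix n n R) {i p : n} (hip : i ≠ p)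
    {Y : Matrix n n R} (hY : Y.IsSymm) :
    ∑ l, ((A.updateRow i (Pi.single l 1)).updateRow p (Y l)).det = 0 := by
  simp only [det_updateRow_eq_sum _ p (Y _)]
  refine sum_sum_mul_eq_zero_of_alternating hY _ (fun l => ?_)
    fun l m => det_updateRow_updateRow_swap A hip _ _
  exact det_zero_of_row_eq hip (by simp [updateRow_ne hip])

theorem sum_mul_det_updateRow_single (A : Matrix n n R) {i p : n} (hip : i ≠ p) :
    ∑ l, A p l * ((A.updateRow i (Pi.single l 1)).updateRow p (A i)).det = -A.det := by
  simp only [updateRow_comm _ hip, ← det_updateRow_eq_sum]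
  rw [updateRow_comm _ hip.symm, det_updateRow_updateRow_swap _ hip]
  simp

end Alternating

variable {K R O ι : Type*} [CommRing K] [CommRing R] [CommRing O] [Algebra K R] [Algebra K O]
variable {d : ι → ι → Derivation K R R} {Y : Matrix ι ι R} {γ : K}

theorem derivation_adjugate {n : Type*} [Fintype n] [DecidableEq n]
    (hd : ∀ i j k l, d i j (Y k l) = γ • (Y k i * Y j l + Y k j * Y i l)) (r c : n → ι) (i l : n) :
    d (r i) (c l) ((Y.submatrix r c).adjugate l i) = γ • ∑ p ∈ Finset.univ.erase i,
      (Y (r p) (r i) * (((Y.submatrix r c).updateRow i (Pi.single l 1)).updateRow p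
          (Y.submatrix c c l)).det +
        Y (r p) (c l) * (((Y.submatrix r c).updateRow i (Pi.single l 1)).updateRow p
          (Y.submatrix r c i)).det) := by
  have hrow : (fun j => d (r i) (c l) ((Y.submatrix r c).updateRow i (Pi.single l 1) i j)) = 0 := by
    ext j
    rcases eq_or_ne j l with rfl | hj <;> simp [*]
  rw [adjugate_apply, derivation_det, ← Finset.add_sum_erase _ _ (Finset.mem_univ i), hrow,
    det_eq_zero_of_row_eq_zero i (by simp), zero_add, Finset.smul_sum]
  refine Finset.sum_congr rfl fun p hp => ?_
  rw [← det_updateRow_smul, ← det_updateRow_smul, ← det_updateRow_add, Algebra.smul_def,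
    ← det_updateRow_smul]
  congr 2
  ext j
  simp [updateRow_ne (Finset.ne_of_mem_erase hp), hd, Algebra.smul_def]

theorem sum_derivation_adjugate {n : Type*} [Fintype n] [DecidableEq n] (hY : Y.IsSymm)
    (hd : ∀ i j k l, d i j (Y k l) = γ • (Y k i * Y j l + Y k j * Y i l)) (r c : n → ι) (i : n) :
    ∑ l, d (r i) (c l) ((Y.submatrix r c).adjugate l i) =
      -((((Fintype.card n : K) - 1) * γ) • (Y.submatrix r c).det) := by
  simp only [derivation_adjugate hd]
  rw [← Finset.smul_sum, Finset.sum_comm]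
  have hp : ∀ p ∈ Finset.univ.erase i, ∑ l : n,
      (Y (r p) (r i) * (((Y.submatrix r c).updateRow i (Pi.single l 1)).updateRow p
          (Y.submatrix c c l)).det +
        Y (r p) (c l) * (((Y.submatrix r c).updateRow i (Pi.single l 1)).updateRow p
          (Y.submatrix r c i)).det) = -(Y.submatrix r c).det := fun p hp => by
    have hip := (Finset.ne_of_mem_erase hp).symm
    rw [Finset.sum_add_distrib, ← Finset.mul_sum,
      sum_det_updateRow_single_eq_zero _ hip (hY.submatrix c), mul_zero, zero_add]
    exact sum_mul_det_updateRow_single (Y.submatrix r c) hip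
  rw [Finset.sum_congr rfl hp, Finset.sum_const, Finset.card_erase_of_mem (Finset.mem_univ i),
    ← Nat.cast_smul_eq_nsmul K, Finset.card_univ, smul_smul, smul_neg, mul_comm γ,
    Nat.cast_pred (Fintype.card_pos_iff.mpr ⟨i⟩)]

theorem det_mem_subalgebra {n : Type*} [Fintype n] [DecidableEq n] (S : Subalgebra K R)
    {A : Matrix n n R} (hA : ∀ i j, A i j ∈ S) : A.det ∈ S := by
  rw [det_apply']
  exact S.sum_mem fun τ _ => S.mul_mem (S.intCast_mem _) (S.prod_mem fun i _ => hA _ _)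

/-- Expanding along the first row, the `k`-th step contributes the factor `-(β + (k - 1) * γ)`. -/
theorem cayley_identity_submatrix (Φ : O →ₐ[K] Module.End K R) (b : Matrix ι ι O) (β : K)
    (S : Subalgebra K R) (hYS : ∀ i j, Y i j ∈ S) (hY : Y.IsSymm)
    (hd : ∀ i j k l, d i j (Y k l) = γ • (Y k i * Y j l + Y k j * Y i l)) (Ψ : ℕ → R)
    (hb : ∀ i j, ∀ h ∈ S, ∀ m, Φ (b i j) (h * Ψ (m + 1)) = (d i j h - β • (Y i j * h)) * Ψ m)
    (k : ℕ) (r c : Fin k → ι) (m : ℕ) :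
    Φ (b.submatrix r c).det (Ψ (m + k)) =
      ((-1) ^ k * ∏ j ∈ Finset.range k, (β + j * γ)) • ((Y.submatrix r c).det * Ψ m) := by
  induction k generalizing m with
  | zero => simp
  | succ k ih =>
    set a : K := (-1) ^ k * ∏ j ∈ Finset.range k, (β + j * γ) with ha
    have hS : ∀ l, (Y.submatrix r c).adjugate l 0 ∈ S := fun l => by
      rw [adjugate_fin_succ_eq_det_submatrix]
      exact S.mul_mem (S.pow_mem (S.neg_mem S.one_mem) _)
        (det_mem_subalgebra S fun _ _ => hYS _ _)
    have hadj : ∀ l, Φ ((b.submatrix r c).adjugate l 0) (Ψ (m + (k + 1))) =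
        a • ((Y.submatrix r c).adjugate l 0 * Ψ (m + 1)) := fun l => by
      have := ih (r ∘ Fin.succ) (c ∘ l.succAbove) (m + 1)
      rw [add_assoc, add_comm 1 k] at this
      have hsign : ((-1 : O) ^ (0 + l : ℕ)) = algebraMap K O ((-1) ^ (l : ℕ)) := by simp
      simp only [adjugate_fin_succ_eq_det_submatrix, submatrix_submatrix, Fin.succAbove_zero,
        Fin.val_zero, hsign, map_mul, AlgHom.commutes, Module.End.mul_apply, this,
        Module.algebraMap_end_apply]
      rw [smul_comm, zero_add, Algebra.smul_def (_ ^ _), mul_assoc]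
      simp
    calc Φ (b.submatrix r c).det (Ψ (m + (k + 1)))
        = ∑ l, a • ((d (r 0) (c l) ((Y.submatrix r c).adjugate l 0) -
            β • (Y (r 0) (c l) * (Y.submatrix r c).adjugate l 0)) * Ψ m) := by
          simp only [det_eq_sum_mul_adjugate_row _ (0 : Fin (k + 1)), map_sum, LinearMap.sum_apply,
            map_mul, Module.End.mul_apply, hadj, map_smul, submatrix_apply, hb _ _ _ (hS _)]
      _ = a • ((-((k * γ) • (Y.submatrix r c).det) - β • (Y.submatrix r c).det) * Ψ m) := by
          have hdet := det_eq_sum_mul_adjugate_row (Y.submatrix r c) 0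
          simp only [submatrix_apply] at hdet
          rw [← Finset.smul_sum, ← Finset.sum_mul, Finset.sum_sub_distrib, ← Finset.smul_sum,
            sum_derivation_adjugate hY hd, ← hdet, Fintype.card_fin, Nat.cast_succ,
            add_sub_cancel_right]
      _ = _ := by
          rw [Finset.prod_range_succ, ← neg_smul, ← sub_smul, smul_mul_assoc, smul_smul, ha]
          congr 1
          ring

end Cayley

section Frame

open Matrix

theorem one_half_smul_add_one_half_smul {K V : Type*} [DivisionRing K] [CharZero K]
    [AddCommGroup V] [Module K V] (x : V) : (1 / 2 : K) • x + (1 / 2 : K) • x = x := by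
  rw [← add_smul, add_halves, one_smul]

/-- Coordinates on the parameter space of a Feynman integral: the matrices `Λ` and `Q` of the
quadratic and of the linear part in the loop momenta and the constant part `J`, with the Gram
matrix `g` of the external momenta, and derivations `σ i j`, `τ i r`, `T` dual (up to sign and
normalization) to `Λ i j`, `Q i r`, `J`. -/
structure MomentumFrame (K ι κ R : Type*) [Field K] [CommRing R] [Algebra K R] [Fintype ι]
    [DecidableEq ι] [Fintype κ] [DecidableEq κ] where
  T : Derivation K R R
  σ : ι → ι → Derivation K R R
  τ : ι → κ → Derivation K R R
  Λ : Matrix ι ι R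
  Q : Matrix ι κ R
  J : R
  g : Matrix κ κ K
  isSymm_Λ : Λ.IsSymm
  isUnit_det_Λ : IsUnit Λ.det
  isSymm_g : g.IsSymm
  isUnit_det_g : IsUnit g.det
  T_σ : ∀ i j h, T (σ i j h) = σ i j (T h)
  T_Λ : Λ.map T = 0
  T_Q : Q.map T = 0
  T_J : T J = 1
  σ_Λ : ∀ i j, Λ.map (σ i j) = -((1 / 2 : K) • (single i j 1 + single j i 1))
  σ_Q : ∀ i j, Q.map (σ i j) = 0
  σ_J : ∀ i j, σ i j J = 0
  τ_Λ : ∀ i r, Λ.map (τ i r) = 0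
  τ_Q : ∀ i r, Q.map (τ i r) = (1 / 2 : K) • single i r 1
  τ_J : ∀ i r, τ i r J = 0

namespace MomentumFrame

variable {K ι κ R : Type*} [Field K] [CommRing R] [Algebra K R] [Fintype ι] [DecidableEq ι]
  [Fintype κ] [DecidableEq κ] (M : MomentumFrame K ι κ R)

theorem T_inv : M.Λ⁻¹.map M.T = 0 := by
  simp [map_derivation_inv _ M.isUnit_det_Λ, M.T_Λ]

theorem τ_inv (i : ι) (r : κ) : M.Λ⁻¹.map (M.τ i r) = 0 := by
  simp [map_derivation_inv _ M.isUnit_det_Λ, M.τ_Λ]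

theorem σ_inv_apply (i j k l : ι) : M.σ i j (M.Λ⁻¹ k l) =
    (1 / 2 : K) • (M.Λ⁻¹ k i * M.Λ⁻¹ j l + M.Λ⁻¹ k j * M.Λ⁻¹ i l) := by
  rw [← map_apply (f := M.σ i j), map_derivation_inv _ M.isUnit_det_Λ, M.σ_Λ]
  simp [Matrix.mul_add, Matrix.add_mul, mul_apply, single_apply, ite_and]

theorem T_det : M.T M.Λ.det = 0 := by
  simp [derivation_det_eq_mul_trace _ M.isUnit_det_Λ, M.T_Λ]

theorem τ_det (i : ι) (r : κ) : M.τ i r M.Λ.det = 0 := by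
  simp [derivation_det_eq_mul_trace _ M.isUnit_det_Λ, M.τ_Λ]

/-- The Gram matrix of the external momenta with entries in `R`. -/
def gramR : Matrix κ κ R := M.g.map (algebraMap K R)

/-- The matrix `V = Λ⁻¹ Q`: its rows are the loop momenta at the critical point of the quadratic
form in the exponent. -/
noncomputable def V : Matrix ι κ R := M.Λ⁻¹ * M.Q

/-- The critical value `z = J + Qᵀ Λ⁻¹ Q`, in which `Q` is paired with itself through the Gram
matrix. -/
noncomputable def z : R := M.J + (M.Λ⁻¹ * (M.Q * M.gramR * M.Qᵀ)).trace

theorem map_gramR (D : Derivation K R R) : M.gramR.map D = 0 := by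
  ext r s
  simp [gramR]

theorem isSymm_gramR : M.gramR.IsSymm := M.isSymm_g.map _

theorem isSymm_V_mul_gramR_mul_transpose : (M.V * M.gramR * M.Vᵀ).IsSymm := by
  rw [IsSymm, transpose_mul, transpose_mul, transpose_transpose, M.isSymm_gramR.eq,
    Matrix.mul_assoc]

theorem derivation_z (D : Derivation K R R) :
    D M.z = D M.J - (M.Λ.map D * (M.V * M.gramR * M.Vᵀ)).trace +
      2 * (M.Q.map D * (M.gramR * M.Vᵀ)).trace := by
  have hV : M.Vᵀ = M.Qᵀ * M.Λ⁻¹ := by rw [V, transpose_mul, M.isSymm_Λ.inv.eq]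
  have hΛ : (M.Λ⁻¹ * M.Λ.map D * M.Λ⁻¹ * (M.Q * M.gramR * M.Qᵀ)).trace =
      (M.Λ.map D * (M.V * M.gramR * M.Vᵀ)).trace := by
    rw [hV, V, Matrix.mul_assoc, Matrix.mul_assoc, trace_mul_comm]
    simp only [Matrix.mul_assoc]
  have hQ : (M.Λ⁻¹ * (M.Q.map D * M.gramR * M.Qᵀ)).trace =
      (M.Q.map D * (M.gramR * M.Vᵀ)).trace := by
    rw [hV, trace_mul_comm]
    simp only [Matrix.mul_assoc]
  have hQt : (M.Λ⁻¹ * (M.Q * M.gramR * M.Qᵀ.map D)).trace =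
      (M.Λ⁻¹ * (M.Q.map D * M.gramR * M.Qᵀ)).trace := by
    rw [← trace_transpose]
    simp only [transpose_mul, M.isSymm_Λ.inv.eq, M.isSymm_gramR.eq, transpose_transpose,
      transpose_map]
    rw [trace_mul_comm, Matrix.mul_assoc]
  rw [z, map_add, derivation_trace, map_derivation_mul, map_derivation_mul, map_derivation_mul,
    map_gramR, map_derivation_inv _ M.isUnit_det_Λ, Matrix.mul_zero, add_zero, Matrix.mul_add,
    trace_add, trace_add, hQt, hQ, Matrix.neg_mul, trace_neg, hΛ]
  ring

theorem T_z : M.T M.z = 1 := by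
  simp [derivation_z, M.T_J, M.T_Λ, M.T_Q]

theorem T_V : M.V.map M.T = 0 := by
  rw [V, map_derivation_mul, T_inv, M.T_Q, Matrix.zero_mul, Matrix.mul_zero, add_zero]

theorem τ_V_apply (i j : ι) (r : κ) : M.τ i r (M.V j r) = (1 / 2 : K) • M.Λ⁻¹ i j := by
  rw [← map_apply (f := M.τ i r), V, map_derivation_mul, τ_inv, M.τ_Q, M.isSymm_Λ.inv.apply]
  simp

/-- The divided powers `det Λ ^ a * z ^ m / m!`, normalized so that `T` lowers `m` by one. -/
noncomputable def Ψ (a m : ℕ) : R := (m.factorial : K)⁻¹ • (M.Λ.det ^ a * M.z ^ m)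

theorem derivation_Ψ (D : Derivation K R R) {ξ : R} (hξ : D M.Λ.det = M.Λ.det * ξ) (a m : ℕ) :
    D (M.Ψ a m) = a * ξ * M.Ψ a m + D M.z * M.T (M.Ψ a m) := by
  simp only [Ψ, Derivation.map_smul, mul_smul_comm, ← smul_add]
  congr 1
  simp only [Derivation.leibniz, Derivation.leibniz_pow, T_det, T_z, hξ]
  rcases a with _ | a
  · simp
    ring
  · simp [pow_succ]
    ring

/-- The functions of `Λ` and of the Gram matrix alone, characterized as the elements killed by `T`
and by all `τ i r`. -/
def invariants : Subalgebra K R where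
  carrier := {h | M.T h = 0 ∧ ∀ i r, M.τ i r h = 0}
  mul_mem' ha hb := by simp [Derivation.leibniz, ha.1, hb.1, ha.2, hb.2]
  add_mem' ha hb := by simp [ha.1, hb.1, ha.2, hb.2]
  algebraMap_mem' c := by simp

theorem inv_mem_invariants (i j : ι) : M.Λ⁻¹ i j ∈ M.invariants :=
  ⟨congr_fun₂ M.T_inv i j, fun k r => congr_fun₂ (M.τ_inv k r) i j⟩

/-- The operator that the entry `i j` of a Schur complement of the Gram matrix of all momenta
becomes when scalar products are replaced by derivations. -/
noncomputable def heat (i j : ι) : Module.End K R :=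
  M.T.toLinearMap ∘ₗ (M.σ i j).toLinearMap -
    ∑ r, ∑ s, M.g⁻¹ r s • (M.τ i r).toLinearMap ∘ₗ (M.τ j s).toLinearMap

variable [CharZero K]

theorem σ_det (i j : ι) : M.σ i j M.Λ.det = -(M.Λ.det * M.Λ⁻¹ i j) := by
  rw [derivation_det_eq_mul_trace _ M.isUnit_det_Λ, M.σ_Λ]
  simp [Matrix.mul_add, trace_mul_single, M.isSymm_Λ.inv.apply i j, -one_div, -neg_add_rev,
    one_half_smul_add_one_half_smul]

theorem σ_z (i j : ι) : M.σ i j M.z = (M.V * M.gramR * M.Vᵀ) i j := by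
  rw [derivation_z, M.σ_J, M.σ_Λ, M.σ_Q]
  simp [Matrix.add_mul, trace_single_mul, M.isSymm_V_mul_gramR_mul_transpose.apply i j, -one_div,
    one_half_smul_add_one_half_smul]

theorem τ_z (i : ι) (r : κ) : M.τ i r M.z = (M.V * M.gramR) i r := by
  have hsymm : (M.gramR * M.Vᵀ) r i = (M.V * M.gramR) i r := by
    rw [← transpose_apply (M.V * M.gramR), transpose_mul, M.isSymm_gramR.eq]
  rw [derivation_z, M.τ_J, M.τ_Λ, M.τ_Q]
  simp [trace_single_mul, two_mul, -one_div, one_half_smul_add_one_half_smul, hsymm]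

theorem T_Ψ (a m : ℕ) : M.T (M.Ψ a (m + 1)) = M.Ψ a m := by
  have hfact : ((m + 1).factorial : K)⁻¹ * (m + 1 : ℕ) = (m.factorial : K)⁻¹ := by
    have hm : ((m + 1 : ℕ) : K) ≠ 0 := Nat.cast_ne_zero.mpr m.succ_ne_zero
    rw [Nat.factorial_succ, Nat.cast_mul, _root_.mul_inv_rev, inv_mul_cancel_right₀ hm]
  rw [Ψ, Ψ, ← hfact, mul_smul, Derivation.map_smul, Derivation.leibniz, Derivation.leibniz_pow,
    Derivation.leibniz_pow, T_det, T_z, Nat.cast_smul_eq_nsmul]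
  simp [mul_left_comm]

theorem T_iterate_Ψ (a m k : ℕ) : M.T^[k] (M.Ψ a (m + k)) = M.Ψ a m := by
  induction k with
  | zero => rfl
  | succ k ih => rw [Function.iterate_succ_apply, ← add_assoc, T_Ψ, ih]

variable {M}

theorem T_σ_mul_Ψ {h : R} (hh : h ∈ M.invariants) (i j : ι) (a m : ℕ) :
    M.T (M.σ i j (h * M.Ψ a (m + 1))) = (M.σ i j h - a * M.Λ⁻¹ i j * h) * M.Ψ a m +
      h * (M.V * M.gramR * M.Vᵀ) i j * M.T (M.Ψ a m) := by
  have hV : M.T ((M.V * M.gramR * M.Vᵀ) i j) = 0 := by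
    rw [← map_apply (f := M.T), map_derivation_mul, map_derivation_mul, map_gramR, transpose_map,
      T_V]
    simp
  have hσdet : M.σ i j M.Λ.det = M.Λ.det * -M.Λ⁻¹ i j := by rw [σ_det, mul_neg]
  rw [Derivation.leibniz, M.derivation_Ψ _ hσdet, T_Ψ, σ_z]
  simp only [smul_eq_mul, map_add, Derivation.leibniz, hh.1, hV, T_Ψ, (M.inv_mem_invariants i j).1,
    map_neg, M.T_σ, Derivation.map_natCast, map_zero]
  ring

theorem τ_mul_Ψ (i : ι) (r : κ) (h : R) (a m : ℕ) :
    M.τ i r (h * M.Ψ a m) =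
      M.τ i r h * M.Ψ a m + h * (M.V * M.gramR) i r * M.T (M.Ψ a m) := by
  have hdet : M.τ i r M.Λ.det = M.Λ.det * 0 := by rw [τ_det, mul_zero]
  rw [Derivation.leibniz, M.derivation_Ψ _ hdet, τ_z, smul_eq_mul, smul_eq_mul]
  ring

theorem sum_inv_smul_τ_mul_Ψ {h : R} (hh : h ∈ M.invariants) (j : ι) (r : κ) (a m : ℕ) :
    ∑ s, M.g⁻¹ r s • M.τ j s (h * M.Ψ a (m + 1)) = h * M.V j r * M.Ψ a m := by
  have hginv : (M.V * M.gramR) * (M.g⁻¹).map (algebraMap K R) = M.V := by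
    rw [gramR, Matrix.mul_assoc, ← Matrix.map_mul, mul_nonsing_inv _ M.isUnit_det_g,
      Matrix.map_one _ (map_zero _) (map_one _), Matrix.mul_one]
  have hV : ∑ s, M.g⁻¹ r s • (M.V * M.gramR) j s = M.V j r := by
    conv_rhs => rw [← hginv, mul_apply]
    exact Finset.sum_congr rfl fun s _ => by
      rw [map_apply, M.isSymm_g.inv.apply, Algebra.smul_def, mul_comm]
  rw [← hV, Finset.mul_sum, Finset.sum_mul]
  refine Finset.sum_congr rfl fun s _ => ?_
  rw [τ_mul_Ψ, hh.2, T_Ψ, zero_mul, zero_add, mul_smul_comm, smul_mul_assoc]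

theorem heat_mul_Ψ {h : R} (hh : h ∈ M.invariants) (i j : ι) (a m : ℕ) :
    M.heat i j (h * M.Ψ a (m + 1)) =
      (M.σ i j h - (a + Fintype.card κ / 2 : K) • (M.Λ⁻¹ i j * h)) * M.Ψ a m := by
  have hτ : ∀ r, M.τ i r (h * M.V j r * M.Ψ a m) = (1 / 2 : K) • (M.Λ⁻¹ i j * h) * M.Ψ a m +
      h * ((M.V * M.gramR) i r * M.V j r) * M.T (M.Ψ a m) := fun r => by
    rw [τ_mul_Ψ, Derivation.leibniz, hh.2, τ_V_apply]
    simp only [smul_eq_mul, Algebra.smul_def]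
    ring
  have hsum : ∑ r, (M.V * M.gramR) i r * M.V j r = (M.V * M.gramR * M.Vᵀ) i j := by
    simp only [mul_apply (N := M.Vᵀ), transpose_apply]
  calc M.heat i j (h * M.Ψ a (m + 1))
      = M.T (M.σ i j (h * M.Ψ a (m + 1))) -
          ∑ r, M.τ i r (∑ s, M.g⁻¹ r s • M.τ j s (h * M.Ψ a (m + 1))) := by
        simp [heat, map_sum]
    _ = _ := by
        rw [T_σ_mul_Ψ hh]
        simp only [sum_inv_smul_τ_mul_Ψ hh, hτ, Finset.sum_add_distrib, ← Finset.sum_mul,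
          ← Finset.mul_sum, hsum, Finset.sum_const, Finset.card_univ]
        simp only [← Nat.cast_smul_eq_nsmul K, Algebra.smul_def, map_add, map_mul, map_natCast,
          div_eq_mul_inv, one_mul]
        ring

section DetHeat

variable {L : ℕ} {M : MomentumFrame K (Fin L) κ R} {O : Type*} [CommRing O] [Algebra K O]
  {Φ : O →ₐ[K] Module.End K R} {b : Matrix (Fin L) (Fin L) O}

theorem det_heat_Ψ (hb : ∀ i j, Φ (b i j) = M.heat i j) (a m : ℕ) :
    Φ b.det (M.Ψ a (m + L)) =
      ((-1) ^ L * ∏ j ∈ Finset.range L, (a + Fintype.card κ / 2 + j * (1 / 2) : K)) •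
        (M.Λ⁻¹.det * M.Ψ a m) :=
  cayley_identity_submatrix Φ b (a + Fintype.card κ / 2) M.invariants M.inv_mem_invariants
    M.isSymm_Λ.inv M.σ_inv_apply (M.Ψ a) (fun i j h hh m => by rw [hb, heat_mul_Ψ hh]) L id id m

theorem det_mul_z_pow (n : ℕ) : (M.Λ.det * M.z) ^ n = (n.factorial : K) • M.Ψ n n := by
  rw [Ψ, smul_inv_smul₀ (Nat.cast_ne_zero.mpr n.factorial_ne_zero), mul_pow]

/-- The factor `t ^ L` is compensated by raising the exponent of `z` in the divided powers. -/
theorem apply_det_mul_z_pow (hb : ∀ i j, Φ (b i j) = M.heat i j) {t p : O} {c : K}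
    (ht : Φ t = M.T.toLinearMap) (hp : t ^ L * p = t * (c • b.det)) (n : ℕ) :
    Φ p ((M.Λ.det * M.z) ^ (n + 1)) =
      (c * (-1) ^ L * ((n + 1) * ∏ j ∈ Finset.range L,
        ((n + 1 : ℕ) + Fintype.card κ / 2 + j * (1 / 2) : K))) • (M.Λ.det * M.z) ^ n := by
  have hraise : M.Ψ (n + 1) (n + 1) = Φ (t ^ L) (M.Ψ (n + 1) (n + 1 + L)) := by
    rw [map_pow, ht, ← T_iterate_Ψ (M := M) _ _ L, Module.End.pow_apply]
    rfl
  have hT : M.T (M.Λ⁻¹.det * M.Ψ (n + 1) (n + 1)) = M.Ψ n n := by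
    have hdet : M.T M.Λ⁻¹.det = 0 :=
      (det_mem_subalgebra M.invariants M.inv_mem_invariants).1
    rw [Derivation.leibniz, hdet, smul_zero, add_zero, T_Ψ, Ψ, Ψ, smul_eq_mul, mul_smul_comm,
      ← mul_assoc, pow_succ', ← mul_assoc, det_nonsing_inv,
      Ring.inverse_mul_cancel _ M.isUnit_det_Λ, one_mul]
  rw [det_mul_z_pow, det_mul_z_pow, map_smul, hraise, ← Module.End.mul_apply, ← map_mul, mul_comm p,
    hp, map_mul, map_smul, ht, Module.End.mul_apply, LinearMap.smul_apply, det_heat_Ψ hb]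
  simp only [map_smul, Derivation.coeFn_coe, hT, smul_smul,
    Nat.factorial_succ]
  push_cast
  congr 1
  ring

end DetHeat

end MomentumFrame

end Frame

theorem commute_pderiv {σ R : Type*} [CommRing R] (i j : σ) :
    Commute (MvPolynomial.pderiv (R := R) i).toLinearMap
      (MvPolynomial.pderiv (R := R) j).toLinearMap := by
  classical
  have h : ⁅MvPolynomial.pderiv (R := R) i, MvPolynomial.pderiv (R := R) j⁆ = 0 := by
    apply MvPolynomial.derivation_ext
    intro k
    simp only [Derivation.commutator_apply, MvPolynomial.pderiv_X, Pi.single_apply]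
    split_ifs <;> simp
  exact LinearMap.ext fun p => sub_eq_zero.mp (DFunLike.congr_fun h p)

/-- The differential operator `p(∂)` with constant coefficients whose symbol is `p`. -/
noncomputable def pderivOp {σ R : Type*} [CommRing R] :
    MvPolynomial σ R →ₐ[R] Module.End R (MvPolynomial σ R) :=
  commAeval (fun i => (MvPolynomial.pderiv i).toLinearMap) commute_pderiv

theorem BernsteinSato.commute_locDeriv {K R S : Type*} [CommRing K] [CommRing R] [CommRing S]
    [Algebra K R] [Algebra R S] [Algebra K S] [IsScalarTower K R S] {d₁ d₂ : Derivation K R R}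
    (f : R) [IsLocalization.Away f S] (h : Commute d₁.toLinearMap d₂.toLinearMap) :
    Commute (locDeriv S d₁ f).toLinearMap (locDeriv S d₂ f).toLinearMap := by
  have h0 : ⁅locDeriv S d₁ f, locDeriv S d₂ f⁆ = 0 := by
    apply derivation_ext f
    intro p
    have hp : d₁ (d₂ p) = d₂ (d₁ p) := LinearMap.congr_fun h p
    simp [Derivation.commutator_apply, locDeriv_algebraMap, hp]
  exact LinearMap.ext fun z => sub_eq_zero.mp (DFunLike.congr_fun h0 z)

namespace LoopPair

variable {L E : ℕ}

theorem mk_inl_eq_mk_inl (i j k l : Fin L) :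
    (mk i (.inl j) : LoopPair L E) = mk k (.inl l) ↔ (i = k ∧ j = l) ∨ (i = l ∧ j = k) := by
  simp [mk]

theorem mk_inl_comm (i j : Fin L) : (mk i (.inl j) : LoopPair L E) = mk j (.inl i) := by
  simp [mk_inl_eq_mk_inl]

theorem mk_inl_ne_mk_inr (i j k : Fin L) (r : Fin E) :
    (mk i (.inl j) : LoopPair L E) ≠ mk k (.inr r) := by
  simp [mk]

theorem mk_inr_eq_mk_inr (i k : Fin L) (r s : Fin E) :
    (mk i (.inr r) : LoopPair L E) = mk k (.inr s) ↔ i = k ∧ r = s := by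
  simp [mk]

end LoopPair

namespace IntegralFamily

open MvPolynomial

variable {L E N : ℕ} (F : IntegralFamily L E N)

theorem isSymm_loopMatrix : F.loopMatrix.IsSymm := by
  ext i j
  simp [loopMatrix, LoopPair.mk_inl_comm j i, eq_comm]

theorem isSymm_linearGram : F.linearGram.IsSymm := by
  rw [Matrix.IsSymm, linearGram, Matrix.transpose_mul, Matrix.transpose_mul,
    Matrix.transpose_transpose, (F.gram_symm.map C).eq, Matrix.mul_assoc]

theorem symanzikF_eq_trace : F.symanzikF =
    (F.loopMatrix.adjugate * F.linearGram).trace + F.symanzikU * F.constPart := by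
  rw [symanzikF, ← F.isSymm_linearGram.eq, ← Matrix.sum_hadamard_eq, F.isSymm_linearGram.eq]
  rfl

/-- The homogenization `y * 𝓤 + 𝓕` of the Lee-Pomeransky polynomial, with the additional
variable `y = X none`. -/
noncomputable def homLeePomeransky : MvPolynomial (Option (Fin N)) ℂ :=
  X none * rename some F.symanzikU + rename some F.symanzikF

/-- The ring `ℂ[x, y, 1/𝓤]`, in which `Λ` is invertible. -/
abbrev LocRing : Type := Localization.Away (rename some F.symanzikU : MvPolynomial _ ℂ)

/-- The map from `ℂ[x]` to `ℂ[x, y, 1/𝓤]`. -/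
noncomputable def toLoc : MvPolynomial (Fin N) ℂ →ₐ[ℂ] F.LocRing :=
  (IsScalarTower.toAlgHom ℂ (MvPolynomial (Option (Fin N)) ℂ) F.LocRing).comp (rename some)

theorem toLoc_apply (p : MvPolynomial (Fin N) ℂ) :
    F.toLoc p = algebraMap _ F.LocRing (rename some p) := rfl

/-- The partial derivatives of `ℂ[x, y, 1/𝓤]`. -/
noncomputable def locPartial (v : Option (Fin N)) : Derivation ℂ F.LocRing F.LocRing :=
  BernsteinSato.locDeriv F.LocRing (pderiv v) (rename some F.symanzikU)

theorem locPartial_algebraMap (v : Option (Fin N)) (p : MvPolynomial (Option (Fin N)) ℂ) :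
    F.locPartial v (algebraMap _ F.LocRing p) = algebraMap _ F.LocRing (pderiv v p) :=
  BernsteinSato.locDeriv_algebraMap ..

theorem commute_locPartial (v w : Option (Fin N)) :
    Commute (F.locPartial v).toLinearMap (F.locPartial w).toLinearMap :=
  BernsteinSato.commute_locDeriv _ (commute_pderiv v w)

/-- The operator `p(∂)` with constant coefficients on `ℂ[x, y, 1/𝓤]`. -/
noncomputable def locOp : MvPolynomial (Option (Fin N)) ℂ →ₐ[ℂ] Module.End ℂ F.LocRing :=
  commAeval (fun v => (F.locPartial v).toLinearMap) F.commute_locPartial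

theorem algebraMap_pderivOp (p q : MvPolynomial (Option (Fin N)) ℂ) :
    algebraMap _ F.LocRing (pderivOp p q) = F.locOp p (algebraMap _ F.LocRing q) := by
  have h := commAeval_intertwines
    (IsScalarTower.toAlgHom ℂ (MvPolynomial (Option (Fin N)) ℂ) F.LocRing).toLinearMap
    commute_pderiv F.commute_locPartial id (fun v z => (F.locPartial_algebraMap v z).symm) p q
  rwa [rename_id_apply] at h

theorem injective_algebraMap_locRing (hU : F.symanzikU ≠ 0) :
    Function.Injective (algebraMap (MvPolynomial (Option (Fin N)) ℂ) F.LocRing) :=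
  IsLocalization.injective _ <| powers_le_nonZeroDivisors_of_noZeroDivisors <|
    (map_ne_zero_iff _ (rename_injective some (Option.some_injective _))).mpr hU

theorem locPartial_none_toLoc (p : MvPolynomial (Fin N) ℂ) : F.locPartial none (F.toLoc p) = 0 := by
  have h : pderiv none (rename some p) = 0 := pderiv_eq_zero_of_notMem_vars fun hp => by
    obtain ⟨a, -, ha⟩ := Finset.mem_image.mp (vars_rename some p hp)
    exact Option.some_ne_none a ha
  rw [toLoc_apply, locPartial_algebraMap, h, map_zero]

theorem locPartial_none_algebraMap_X_none :
    F.locPartial none (algebraMap (MvPolynomial (Option (Fin N)) ℂ) _ (X none)) = 1 := by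
  rw [locPartial_algebraMap, pderiv_X_self, map_one]

theorem locPartial_some_algebraMap_X_none (a : Fin N) :
    F.locPartial (some a) (algebraMap (MvPolynomial (Option (Fin N)) ℂ) _ (X none)) = 0 := by
  rw [locPartial_algebraMap, pderiv_X_of_ne (Option.some_ne_none a).symm, map_zero]

theorem locPartial_some_toLoc_linear (a : Fin N) (c : Fin N → ℂ) :
    F.locPartial (some a) (F.toLoc (∑ a, C (c a) * X a)) = algebraMap ℂ F.LocRing (c a) := by
  rw [toLoc_apply, locPartial_algebraMap, IsScalarTower.algebraMap_apply ℂ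
    (MvPolynomial (Option (Fin N)) ℂ) F.LocRing]
  simp [pderiv_X, Pi.single_apply, algebraMap_eq]

section Frame

variable (B : Matrix (LoopPair L E) (Fin N) ℂ)

/-- If `B` is inverse to the coefficient matrix, the derivation of `ℂ[x, y, 1/𝓤]` dual to the
coefficient of the scalar product `t` in `∑ a, x a * D a`. The multiple of `∂ / ∂ y` is chosen
such that `y + J` is a constant. -/
noncomputable def pairDeriv (t : LoopPair L E) : Derivation ℂ F.LocRing F.LocRing :=
  ∑ a, B t a • (F.locPartial (some a) - F.const a • F.locPartial none)

theorem pairDeriv_apply (t : LoopPair L E) (z : F.LocRing) : F.pairDeriv B t z =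
    ∑ a, B t a • (F.locPartial (some a) z - F.const a • F.locPartial none z) := by
  have h := congr_fun (map_sum Derivation.coeFnAddMonoidHom
    (fun a => B t a • (F.locPartial (some a) - F.const a • F.locPartial none)) Finset.univ) z
  rwa [Finset.sum_apply] at h

/-- The symbol of `pairDeriv B t`. -/
noncomputable def pairSymbol (t : LoopPair L E) : MvPolynomial (Option (Fin N)) ℂ :=
  ∑ a, C (B t a) * (X (some a) - C (F.const a) * X none)

theorem locOp_pairSymbol (t : LoopPair L E) :
    F.locOp (F.pairSymbol B t) = (F.pairDeriv B t).toLinearMap := by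
  ext z
  simp [pairSymbol, pairDeriv_apply, locOp, ← algebraMap_eq, smul_sub]

theorem locPartial_none_pairDeriv (t : LoopPair L E) (z : F.LocRing) :
    F.locPartial none (F.pairDeriv B t z) = F.pairDeriv B t (F.locPartial none z) := by
  have h : ∀ v z, F.locPartial none (F.locPartial v z) = F.locPartial v (F.locPartial none z) :=
    fun v z => LinearMap.congr_fun (F.commute_locPartial none v) z
  simp only [pairDeriv_apply, map_sum, map_sub, Derivation.map_smul, h]

theorem pairDeriv_toLoc_linear (t : LoopPair L E) (c : Fin N → ℂ) :
    F.pairDeriv B t (F.toLoc (∑ a, C (c a) * X a)) =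
      algebraMap ℂ F.LocRing (∑ a, B t a * c a) := by
  rw [pairDeriv_apply]
  simp only [locPartial_none_toLoc, locPartial_some_toLoc_linear, smul_zero, sub_zero]
  simp only [map_sum, map_mul, Algebra.smul_def]

theorem pairDeriv_X_none_add_constPart (t : LoopPair L E) :
    F.pairDeriv B t (algebraMap (MvPolynomial (Option (Fin N)) ℂ) _ (X none) +
      F.toLoc F.constPart) = 0 := by
  rw [map_add, constPart, pairDeriv_toLoc_linear, pairDeriv_apply]
  simp [locPartial_none_algebraMap_X_none, locPartial_some_algebraMap_X_none, Algebra.smul_def]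

variable {F B} (hBA : B * F.coeff = 1)
include hBA

theorem pairDeriv_toLoc_coeff (t u : LoopPair L E) (c : ℂ) :
    F.pairDeriv B t (F.toLoc (∑ a, C (c * F.coeff a u) * X a)) =
      if t = u then algebraMap ℂ F.LocRing c else 0 := by
  have h : ∑ a, B t a * F.coeff a u = if t = u then 1 else 0 := by
    rw [← Matrix.mul_apply, hBA, Matrix.one_apply]
  simp_rw [pairDeriv_toLoc_linear, mul_left_comm _ c, ← Finset.mul_sum, h]
  split_ifs <;> simp

theorem pairDeriv_inl_loopMatrix (i j : Fin L) :
    (F.loopMatrix.map F.toLoc).map (F.pairDeriv B (.mk i (.inl j))) =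
      -((1 / 2 : ℂ) • (Matrix.single i j 1 + Matrix.single j i 1)) := by
  ext k l
  rw [Matrix.map_apply, Matrix.map_apply, loopMatrix, map_neg, map_neg,
    pairDeriv_toLoc_coeff hBA]
  have hhalf := one_half_smul_add_one_half_smul (K := ℂ) (1 : F.LocRing)
  rw [Matrix.neg_apply, Matrix.smul_apply, Matrix.add_apply]
  simp only [LoopPair.mk_inl_eq_mk_inl, Matrix.single_apply, Algebra.smul_def, mul_one] at hhalf ⊢
  by_cases hkl : k = l
  · subst hkl
    by_cases hi : i = k <;> by_cases hj : j = k <;> simp_all [mul_add]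
  · by_cases h₁ : i = k ∧ j = l
    · simp [h₁, hkl]
    · simp [h₁, hkl, and_comm (a := j = k)]

theorem pairDeriv_inl_linearPart (i j : Fin L) :
    (F.linearPart.map F.toLoc).map (F.pairDeriv B (.mk i (.inl j))) = 0 := by
  ext k r
  rw [Matrix.map_apply, Matrix.map_apply, linearPart, pairDeriv_toLoc_coeff hBA,
    if_neg (LoopPair.mk_inl_ne_mk_inr _ _ _ _), Matrix.zero_apply]

theorem pairDeriv_inr_loopMatrix (i : Fin L) (r : Fin E) :
    (F.loopMatrix.map F.toLoc).map (F.pairDeriv B (.mk i (.inr r))) = 0 := by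
  ext k l
  rw [Matrix.map_apply, Matrix.map_apply, loopMatrix, map_neg, map_neg,
    pairDeriv_toLoc_coeff hBA, if_neg (LoopPair.mk_inl_ne_mk_inr _ _ _ _).symm, neg_zero,
    Matrix.zero_apply]

theorem pairDeriv_inr_linearPart (i : Fin L) (r : Fin E) :
    (F.linearPart.map F.toLoc).map (F.pairDeriv B (.mk i (.inr r))) =
      (1 / 2 : ℂ) • Matrix.single i r 1 := by
  ext k s
  rw [Matrix.map_apply, Matrix.map_apply, linearPart, pairDeriv_toLoc_coeff hBA]
  simp [LoopPair.mk_inr_eq_mk_inr, Matrix.single_apply, Algebra.smul_def]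

variable (F) in
omit hBA in
theorem isUnit_det_toLoc_loopMatrix : IsUnit (F.loopMatrix.map F.toLoc).det := by
  have h : algebraMap _ F.LocRing (rename some F.symanzikU) = (F.loopMatrix.map F.toLoc).det :=
    AlgHom.map_det F.toLoc F.loopMatrix
  exact h ▸ IsLocalization.Away.algebraMap_isUnit _

/-- The momentum frame on `ℂ[x, y, 1/𝓤]` of a complete family; the role of `J` is played by
`y + J`. -/
noncomputable def frame (hg : F.gram.det ≠ 0) : MomentumFrame ℂ (Fin L) (Fin E) F.LocRing where
  T := F.locPartial none
  σ i j := F.pairDeriv B (.mk i (.inl j))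
  τ i r := F.pairDeriv B (.mk i (.inr r))
  Λ := F.loopMatrix.map F.toLoc
  Q := F.linearPart.map F.toLoc
  J := algebraMap (MvPolynomial (Option (Fin N)) ℂ) _ (X none) + F.toLoc F.constPart
  g := F.gram
  isSymm_Λ := F.isSymm_loopMatrix.map _
  isUnit_det_Λ := F.isUnit_det_toLoc_loopMatrix
  isSymm_g := F.gram_symm
  isUnit_det_g := isUnit_iff_ne_zero.mpr hg
  T_σ _ _ := F.locPartial_none_pairDeriv B _
  T_Λ := by ext; exact F.locPartial_none_toLoc _
  T_Q := by ext; exact F.locPartial_none_toLoc _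
  T_J := by rw [map_add, locPartial_none_algebraMap_X_none, locPartial_none_toLoc, add_zero]
  σ_Λ := pairDeriv_inl_loopMatrix hBA
  σ_Q := pairDeriv_inl_linearPart hBA
  σ_J _ _ := F.pairDeriv_X_none_add_constPart B _
  τ_Λ := pairDeriv_inr_loopMatrix hBA
  τ_Q := pairDeriv_inr_linearPart hBA
  τ_J _ _ := F.pairDeriv_X_none_add_constPart B _

theorem det_mul_z_frame (hg : F.gram.det ≠ 0) :
    (frame hBA hg).Λ.det * (frame hBA hg).z = algebraMap _ F.LocRing F.homLeePomeransky := by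
  set M := frame hBA hg
  have hU : F.toLoc F.symanzikU = M.Λ.det := AlgHom.map_det F.toLoc F.loopMatrix
  have hadj : M.Λ.adjugate = M.Λ.det • M.Λ⁻¹ := by
    rw [Matrix.inv_def, smul_smul, Ring.mul_inverse_cancel _ M.isUnit_det_Λ, one_smul]
  have hgram : (F.gram.map C).map F.toLoc = M.gramR :=
    Matrix.ext fun r s => F.toLoc.commutes (F.gram r s)
  have hQ : F.linearGram.map F.toLoc = M.Q * M.gramR * M.Q.transpose := by
    rw [linearGram, Matrix.map_mul, Matrix.map_mul, hgram, Matrix.transpose_map]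
    rfl
  have htrace : F.toLoc (F.loopMatrix.adjugate * F.linearGram).trace =
      M.Λ.det * (M.Λ⁻¹ * (M.Q * M.gramR * M.Q.transpose)).trace :=
    calc F.toLoc (F.loopMatrix.adjugate * F.linearGram).trace
        = (F.loopMatrix.adjugate.map F.toLoc * F.linearGram.map F.toLoc).trace := by
          rw [← Matrix.map_mul]
          exact AddMonoidHom.map_trace F.toLoc _
      _ = (M.Λ.adjugate * (M.Q * M.gramR * M.Q.transpose)).trace := by
          rw [hQ]
          congr 2
          exact F.toLoc.map_adjugate F.loopMatrix
      _ = _ := by rw [hadj, Matrix.smul_mul, Matrix.trace_smul, smul_eq_mul]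
  rw [homLeePomeransky, map_add, map_mul, ← toLoc_apply, ← toLoc_apply, symanzikF_eq_trace,
    map_add, map_mul, htrace, hU, MomentumFrame.z]
  change _ * (_ + F.toLoc F.constPart + _) = _
  ring

variable (F B) in
omit hBA in
/-- The symbol of the heat operators of `frame`. -/
noncomputable def heatSymbol : Matrix (Fin L) (Fin L) (MvPolynomial (Option (Fin N)) ℂ) :=
  let τ : Matrix (Fin L) (Fin E) (MvPolynomial (Option (Fin N)) ℂ) :=
    Matrix.of fun i r => F.pairSymbol B (.mk i (.inr r))
  let g' : Matrix (Fin E) (Fin E) (MvPolynomial (Option (Fin N)) ℂ) := F.gram⁻¹.map C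
  (X none : MvPolynomial (Option (Fin N)) ℂ) •
    Matrix.of (fun i j => F.pairSymbol B (.mk i (.inl j))) - τ * g' * τ.transpose

theorem locOp_heatSymbol (hg : F.gram.det ≠ 0) (i j : Fin L) :
    F.locOp (F.heatSymbol B i j) = (frame hBA hg).heat i j := by
  have hX : F.locOp (X none) = (F.locPartial none).toLinearMap := commAeval_X ..
  have hC : ∀ c : ℂ, F.locOp (C c) = algebraMap ℂ _ c := F.locOp.commutes
  simp only [heatSymbol, Matrix.sub_apply, Matrix.smul_apply, Matrix.of_apply, Matrix.mul_apply,
    Matrix.transpose_apply, Matrix.map_apply, smul_eq_mul, Finset.sum_mul, map_sub, map_sum,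
    map_mul, locOp_pairSymbol, hX, hC]
  rw [Finset.sum_comm]
  simp only [← Algebra.commutes, ← Algebra.smul_def, smul_mul_assoc]
  rfl

theorem pderivOp_homLeePomeransky_pow (hg : F.gram.det ≠ 0) (hU : F.symanzikU ≠ 0)
    {p : MvPolynomial (Option (Fin N)) ℂ}
    (hp : X none ^ L * p = X none * (F.gram.det • (F.heatSymbol B).det)) (n : ℕ) :
    pderivOp p (F.homLeePomeransky ^ (n + 1)) =
      (F.gram.det * (-1) ^ L * ((n + 1) * ∏ j ∈ Finset.range L,
        ((n + 1 : ℕ) + E / 2 + j * (1 / 2) : ℂ))) • F.homLeePomeransky ^ n := by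
  apply F.injective_algebraMap_locRing hU
  rw [algebraMap_pderivOp, map_pow, ← det_mul_z_frame hBA hg,
    MomentumFrame.apply_det_mul_z_pow (locOp_heatSymbol hBA hg) (commAeval_X ..) hp,
    det_mul_z_frame, Fintype.card_fin, ← map_pow]
  exact (map_smul (IsScalarTower.toAlgHom ℂ _ F.LocRing) _ _).symm

end Frame
end IntegralFamily

section Homogenization

open MvPolynomial

variable {σ R : Type*} [CommRing R]

theorem pderivOp_X (i : σ) (p : MvPolynomial σ R) : pderivOp (X i) p = pderiv i p :=
  LinearMap.congr_fun (commAeval_X _ commute_pderiv i) p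

/-- The Euler operator `∑ i, x i * ∂ i`, as a derivation. -/
noncomputable def eulerDeriv : Derivation R (MvPolynomial σ R) (MvPolynomial σ R) :=
  mkDerivation R X

theorem eulerDeriv_apply [Fintype σ] (p : MvPolynomial σ R) :
    eulerDeriv p = ∑ i, X i * pderiv i p := by
  induction p using MvPolynomial.induction_on with
  | C c => simp
  | add p q hp hq => simp only [map_add, mul_add, Finset.sum_add_distrib, hp, hq]
  | mul_X p j hp =>
    classical
    have hX : (eulerDeriv (X j) : MvPolynomial σ R) = X j := mkDerivation_X ..
    simp only [Derivation.leibniz, hp, hX, smul_eq_mul, pderiv_X, mul_add,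
      Finset.sum_add_distrib, Finset.mul_sum, mul_left_comm (X j)]
    congr 1
    simp [Pi.single_apply, mul_comm]

theorem eulerDeriv_of_isHomogeneous [Finite σ] {p : MvPolynomial σ R} {d : ℕ}
    (hp : p.IsHomogeneous d) : eulerDeriv p = (d : R) • p := by
  cases nonempty_fintype σ
  rw [eulerDeriv_apply, hp.sum_X_mul_pderiv, Nat.cast_smul_eq_nsmul]

theorem eulerDeriv_pderiv (j : σ) (p : MvPolynomial σ R) :
    eulerDeriv (pderiv j p) = pderiv j (eulerDeriv p) - pderiv j p := by
  classical
  have h : ⁅pderiv (R := R) j, eulerDeriv⁆ = pderiv (R := R) j := by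
    apply derivation_ext
    intro i
    simp only [Derivation.commutator_apply, eulerDeriv, mkDerivation_X, pderiv_X, Pi.single_apply]
    split_ifs <;> simp
  rw [eq_sub_iff_add_eq, ← eq_sub_iff_add_eq', ← Derivation.commutator_apply, h]

theorem eulerDeriv_pderiv_of_eulerDeriv_eq_smul {p : MvPolynomial σ R} {c : R} (j : σ)
    (hp : eulerDeriv p = c • p) : eulerDeriv (pderiv j p) = (c - 1) • pderiv j p := by
  rw [eulerDeriv_pderiv, hp, Derivation.map_smul, sub_smul, one_smul]

/-- The substitution `y = 1` for the additional variable `y = X none`. -/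
noncomputable def dehomogenization : MvPolynomial (Option σ) R →ₐ[R] MvPolynomial σ R :=
  aeval fun v => v.elim 1 X

theorem dehomogenization_X_none : dehomogenization (X none : MvPolynomial (Option σ) R) = 1 :=
  aeval_X ..

theorem dehomogenization_X_some (i : σ) :
    dehomogenization (X (some i) : MvPolynomial (Option σ) R) = X i :=
  aeval_X ..

theorem dehomogenization_rename_some (p : MvPolynomial σ R) :
    dehomogenization (rename some p) = p := by
  rw [dehomogenization, aeval_rename]
  exact aeval_X_left_apply p

theorem dehomogenization_pderiv_some (i : σ) (p : MvPolynomial (Option σ) R) :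
    dehomogenization (pderiv (some i) p) = pderiv i (dehomogenization p) := by
  classical
  induction p using MvPolynomial.induction_on with
  | C c => simp [dehomogenization]
  | add p q hp hq => simp only [map_add, hp, hq]
  | mul_X p v hp =>
    simp only [Derivation.leibniz, map_add, smul_eq_mul, map_mul, hp]
    congr 2
    cases v with
    | none => simp [dehomogenization_X_none, pderiv_X]
    | some b =>
      simp only [dehomogenization_X_some, pderiv_X, Pi.single_apply, Option.some_inj]
      split_ifs <;> simp

theorem dehomogenization_pderiv_none [Finite σ] {p : MvPolynomial (Option σ) R} {c : R}
    (hp : eulerDeriv p = c • p) : dehomogenization (pderiv none p) =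
      c • dehomogenization p - eulerDeriv (dehomogenization p) := by
  cases nonempty_fintype σ
  have h := congrArg dehomogenization hp
  rw [eulerDeriv_apply, Fintype.sum_option] at h
  simp only [map_add, map_sum, map_mul, map_smul, dehomogenization_X_none, one_mul,
    dehomogenization_X_some, dehomogenization_pderiv_some] at h
  rw [← h, eulerDeriv_apply, add_sub_cancel_right]

/-- The homogenization of degree `d` of a polynomial of degree at most `d`, with the additional
variable `X none`. -/
noncomputable def homogenization (d : ℕ) (p : MvPolynomial σ R) : MvPolynomial (Option σ) R :=
  ∑ m ∈ p.support, X none ^ (d - m.degree) * rename some (monomial m (p.coeff m))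

section Scaling

variable {S : Type*} [CommRing S] [Algebra R S] {p : MvPolynomial σ R} {d : ℕ} {w : σ → S} {c : S}

theorem aeval_monomial_of_eq_mul {v : σ → S} (hv : ∀ i, v i = c * w i) (m : σ →₀ ℕ) (a : R) :
    aeval v (monomial m a) = c ^ m.degree * aeval w (monomial m a) := by
  simp only [aeval_monomial, Finsupp.prod, hv, mul_pow, Finset.prod_mul_distrib,
    Finset.prod_pow_eq_pow_sum, Finsupp.degree_apply]
  ring

theorem aeval_of_isHomogeneous_of_eq_mul (hp : p.IsHomogeneous d) {v : σ → S}
    (hv : ∀ i, v i = c * w i) : aeval v p = c ^ d * aeval w p := by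
  rw [p.as_sum, map_sum, map_sum, Finset.mul_sum]
  refine Finset.sum_congr rfl fun m hm => ?_
  rw [aeval_monomial_of_eq_mul hv, Finsupp.degree_apply, ← hp.degree_eq_sum_deg_support hm]

theorem aeval_homogenization (hp : p.totalDegree ≤ d) {v : Option σ → S}
    (hv : ∀ i, v (some i) = v none * w i) :
    aeval v (homogenization d p) = v none ^ d * aeval w p := by
  conv_rhs => rw [p.as_sum]
  rw [homogenization, map_sum, map_sum, Finset.mul_sum]
  refine Finset.sum_congr rfl fun m hm => ?_
  have hmd : m.degree ≤ d := (le_totalDegree hm).trans hp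
  rw [map_mul, map_pow, aeval_X, aeval_rename, aeval_monomial_of_eq_mul (v := v ∘ some) hv,
    ← mul_assoc, ← pow_add, Nat.sub_add_cancel hmd]

end Scaling

theorem X_none_pow_mul_homogenization_dehomogenization [IsDomain R] {p : MvPolynomial (Option σ) R}
    {k d : ℕ} (hp : p.IsHomogeneous (k + d)) (hd : (dehomogenization p).totalDegree ≤ d) :
    X none ^ k * homogenization d (dehomogenization p) = p := by
  set K := FractionRing (MvPolynomial (Option σ) R)
  set ι := IsScalarTower.toAlgHom R (MvPolynomial (Option σ) R) K
  have hι : Function.Injective ι := IsFractionRing.injective _ K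
  have hy : ι (X none) ≠ 0 := (map_ne_zero_iff ι hι).mpr (X_ne_zero none)
  let w : σ → K := fun i => ι (X (some i)) / ι (X none)
  let w₁ : Option σ → K := fun v => v.elim 1 w
  have hw : ∀ i, ι (X (some i)) = ι (X none) * w i := fun i => (mul_div_cancel₀ _ hy).symm
  have hw₁ : ∀ v, ι (X v) = ι (X none) * w₁ v
    | none => (mul_one _).symm
    | some i => hw i
  have hdehom : aeval w₁ p = aeval w (dehomogenization p) := by
    rw [dehomogenization, comp_aeval_apply]
    congr 2
    funext v
    cases v <;> simp [w₁]
  have haeval : ι = aeval fun v => ι (X v) := aeval_unique ι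
  apply hι
  rw [map_mul, map_pow, haeval, aeval_of_isHomogeneous_of_eq_mul hp hw₁,
    aeval_homogenization hd hw, hdehom, aeval_X, pow_add, mul_assoc]

theorem isHomogeneous_det {n : Type*} [Fintype n] [DecidableEq n]
    {M : Matrix n n (MvPolynomial σ R)} {k : ℕ} (hM : ∀ i j, (M i j).IsHomogeneous k) :
    M.det.IsHomogeneous (Fintype.card n * k) := by
  rw [Matrix.det_apply]
  refine IsHomogeneous.sum _ _ _ fun τ _ => ?_
  have h := IsHomogeneous.prod Finset.univ (fun i => M (τ i) i) (fun _ => k) fun i _ => hM _ _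
  rw [Finset.sum_const, smul_eq_mul, Finset.card_univ] at h
  rcases Int.units_eq_one_or (Equiv.Perm.sign τ) with hτ | hτ <;> rw [hτ]
  · rwa [one_smul]
  · rw [Units.neg_smul, one_smul]
    exact h.neg

theorem isHomogeneous_adjugate {n : ℕ} {M : Matrix (Fin (n + 1)) (Fin (n + 1)) (MvPolynomial σ R)}
    {k : ℕ} (hM : ∀ i j, (M i j).IsHomogeneous k) (i j : Fin (n + 1)) :
    (M.adjugate i j).IsHomogeneous (n * k) := by
  have h := isHomogeneous_det (M := M.submatrix j.succAbove i.succAbove) fun _ _ => hM _ _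
  rw [Fintype.card_fin] at h
  rw [Matrix.adjugate_fin_succ_eq_det_submatrix]
  simpa using h.C_mul ((-1) ^ (j + i : ℕ))

theorem totalDegree_det_le {n : Type*} [Fintype n] [DecidableEq n]
    {M : Matrix n n (MvPolynomial σ R)} (u v : n → ℕ)
    (h : ∀ i j, (M i j).totalDegree ≤ u i + v j) :
    M.det.totalDegree ≤ ∑ i, u i + ∑ i, v i := by
  rw [Matrix.det_apply]
  refine totalDegree_finsetSum_le fun τ _ => ?_
  have hprod : (∏ i, M (τ i) i).totalDegree ≤ ∑ i, u i + ∑ i, v i := by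
    refine (totalDegree_finsetProd _ _).trans ?_
    rw [← Equiv.sum_comp τ u, ← Finset.sum_add_distrib]
    exact Finset.sum_le_sum fun i _ => h _ _
  rcases Int.units_eq_one_or (Equiv.Perm.sign τ) with hτ | hτ <;> rw [hτ]
  · rwa [one_smul]
  · rwa [Units.neg_smul, one_smul, totalDegree_neg]

end Homogenization

namespace BernsteinSato

open Polynomial

theorem map_derivation_of_algebraMap {K K' R S S' : Type*} [CommRing K] [CommRing K']
    [CommRing R] [CommRing S] [CommRing S'] [Algebra K S] [Algebra K' S'] [Algebra R S] (f : R)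
    [IsLocalization.Away f S] (D : Derivation K S S) (D' : Derivation K' S' S') (e : S →+* S')
    (h : ∀ g, e (D (algebraMap R S g)) = D' (e (algebraMap R S g))) (z : S) :
    e (D z) = D' (e z) := by
  obtain ⟨⟨g, t⟩, hz⟩ := IsLocalization.surj (Submonoid.powers f) z
  have hu : IsUnit (e (algebraMap R S t)) := (IsLocalization.map_units S t).map e
  have h₁ := congrArg (fun w => e (D w)) hz
  have h₂ := congrArg (fun w => D' (e w)) hz
  simp only [Derivation.leibniz, map_add, map_mul, smul_eq_mul, h] at h₁ h₂
  rw [← h₂] at h₁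
  exact hu.mul_left_cancel (add_left_cancel h₁)

variable {N : ℕ} {f : MvPolynomial (Fin N) ℂ}

/-- The ideal of the polynomials that admit a functional equation. The Bernstein-Sato polynomial
is its monic generator. -/
def functionalIdeal (f : MvPolynomial (Fin N) ℂ) : Ideal ℂ[X] where
  carrier := {b | ∃ P, FunctionalEquation f P b}
  add_mem' := by
    rintro a b ⟨P, hP⟩ ⟨Q, hQ⟩
    exact ⟨P + Q, by rw [FunctionalEquation, map_add, LinearMap.add_apply, hP, hQ, add_smul]⟩
  zero_mem' := ⟨0, by simp [FunctionalEquation]⟩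
  smul_mem' := by
    rintro c b ⟨P, hP⟩
    exact ⟨c • P, by
      rw [FunctionalEquation, map_smul, LinearMap.smul_apply, hP, smul_eq_mul, mul_smul]⟩

section Evaluation

theorem map_eval_map_C (c : ℂ) (g : MvPolynomial (Fin N) ℂ) :
    MvPolynomial.map (evalRingHom c) (MvPolynomial.map Polynomial.C g) = g := by
  have h : (evalRingHom c).comp (Polynomial.C : ℂ →+* ℂ[X]) = RingHom.id ℂ := by ext; simp
  rw [MvPolynomial.map_map, h, MvPolynomial.map_id]

variable (f) in
/-- The specialization `s = c` of the coefficients of `f ^ s`, a map from `ℂ[s, x, 1/f]` to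
`ℂ[x, 1/f]`. -/
noncomputable def evalPow (c : ℂ) : PowModule f →+* Localization.Away f :=
  IsLocalization.Away.lift (MvPolynomial.map (Polynomial.C : ℂ →+* ℂ[X]) f)
    (g := (algebraMap _ (Localization.Away f)).comp (MvPolynomial.map (evalRingHom c))) (by
      rw [RingHom.comp_apply, map_eval_map_C]
      exact IsLocalization.Away.algebraMap_isUnit f)

theorem evalPow_toPow (c : ℂ) (p : MvPolynomial (Fin N) ℂ[X]) :
    evalPow f c (toPow f p) = algebraMap _ _ (MvPolynomial.map (evalRingHom c) p) :=
  IsLocalization.Away.lift_eq _ _ p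

theorem evalPow_base (c : ℂ) : evalPow f c (base f) = algebraMap _ _ f := by
  rw [base, evalPow_toPow, map_eval_map_C]

theorem algebraMap_mul_evalPow_invBase (c : ℂ) :
    algebraMap _ _ f * evalPow f c (invBase f) = 1 := by
  rw [← evalPow_base c, ← map_mul, base_mul_invBase, map_one]

theorem evalPow_smul (c : ℂ) (b : ℂ[X]) (h : PowModule f) :
    evalPow f c (b • h) = b.eval c • evalPow f c h := by
  have hb : b • h = toPow f (MvPolynomial.C b) * h := by
    rw [Algebra.smul_def, IsScalarTower.algebraMap_apply ℂ[X] (MvPolynomial (Fin N) ℂ[X])]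
    rfl
  rw [hb, map_mul, evalPow_toPow, MvPolynomial.map_C, coe_evalRingHom, Algebra.smul_def,
    IsScalarTower.algebraMap_apply ℂ (MvPolynomial (Fin N) ℂ)]
  rfl

theorem evalPow_partialDeriv (c : ℂ) (i : Fin N) (h : PowModule f) :
    evalPow f c (partialDeriv f i h) =
      locDeriv (Localization.Away f) (MvPolynomial.pderiv i) f (evalPow f c h) :=
  map_derivation_of_algebraMap (MvPolynomial.map Polynomial.C f) _ _ _ (fun p => by
    rw [partialDeriv, locDeriv_algebraMap, evalPow_toPow, evalPow_toPow, locDeriv_algebraMap,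
      MvPolynomial.pderiv_map]) h

theorem algebraMap_mul_evalPow_dAct (c : ℂ) (i : Fin N) (h : PowModule f) :
    algebraMap _ _ f * evalPow f c (dAct f i h) =
      algebraMap _ _ f * locDeriv (Localization.Away f) (MvPolynomial.pderiv i) f (evalPow f c h) +
        c • (algebraMap _ _ (MvPolynomial.pderiv i f) * evalPow f c h) := by
  rw [dAct_apply, map_add, evalPow_smul, map_mul, logDeriv, map_mul, evalPow_partialDeriv,
    evalPow_partialDeriv, evalPow_base, locDeriv_algebraMap, eval_X, mul_add, mul_smul_comm]
  congr 2
  linear_combination (algebraMap _ _ (MvPolynomial.pderiv i f) * evalPow f c h) *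
    algebraMap_mul_evalPow_invBase (f := f) c

theorem injective_algebraMap_away (hf : f ≠ 0) :
    Function.Injective (algebraMap (MvPolynomial (Fin N) ℂ) (Localization.Away f)) :=
  IsLocalization.injective _ (powers_le_nonZeroDivisors_of_noZeroDivisors hf)

/-- The polynomials `u n` are the values at `s = n` of the element `h · f ^ s`. -/
def Interpolates (h : PowModule f) (u : ℕ → MvPolynomial (Fin N) ℂ) : Prop :=
  ∀ n : ℕ, algebraMap _ (Localization.Away f) (u n) = evalPow f n h * algebraMap _ _ f ^ n

variable {h h' : PowModule f} {u u' : ℕ → MvPolynomial (Fin N) ℂ}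

theorem Interpolates.add (H : Interpolates h u) (H' : Interpolates h' u') :
    Interpolates (h + h') (u + u') := fun n => by
  rw [Pi.add_apply, map_add, map_add, H n, H' n, add_mul]

theorem Interpolates.smul (H : Interpolates h u) (b : ℂ[X]) :
    Interpolates (b • h) (fun n => b.eval (n : ℂ) • u n) := fun n => by
  rw [evalPow_smul, smul_mul_assoc, ← H n]
  exact map_smul (IsScalarTower.toAlgHom ℂ _ (Localization.Away f)) _ _

theorem Interpolates.xAct (H : Interpolates h u) (i : Fin N) :
    Interpolates (xAct f i h) (fun n => MvPolynomial.X i * u n) := fun n => by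
  rw [BernsteinSato.xAct, LinearMap.mulLeft_apply, map_mul, map_mul, H n, evalPow_toPow,
    MvPolynomial.map_X, mul_assoc]

theorem Interpolates.dAct (H : Interpolates h u) (i : Fin N) :
    Interpolates (dAct f i h) (fun n => MvPolynomial.pderiv i (u n)) := fun n => by
  have hf : IsUnit (algebraMap _ (Localization.Away f) f) :=
    IsLocalization.Away.algebraMap_isUnit f
  apply hf.mul_left_cancel
  rw [← mul_assoc, algebraMap_mul_evalPow_dAct, ← locDeriv_algebraMap (S := Localization.Away f)
    (MvPolynomial.pderiv i) f (u n), H n, Derivation.leibniz, Derivation.leibniz_pow,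
    locDeriv_algebraMap]
  cases n with
  | zero => simp
  | succ n =>
    simp only [Nat.add_sub_cancel, smul_eq_mul, Algebra.smul_def, map_natCast, nsmul_eq_mul]
    ring

theorem eq_zero_of_evalPow_natCast (hf : f ≠ 0) (H : ∀ n : ℕ, evalPow f n h = 0) : h = 0 := by
  obtain ⟨⟨p, t⟩, hp⟩ := IsLocalization.surj
    (Submonoid.powers (MvPolynomial.map (Polynomial.C : ℂ →+* ℂ[X]) f)) h
  have hmap (n : ℕ) : MvPolynomial.map (evalRingHom (n : ℂ)) p = 0 := by
    apply injective_algebraMap_away hf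
    rw [← evalPow_toPow, ← hp, map_mul, H, zero_mul, map_zero]
  have hp0 : p = 0 := by
    ext1 m
    refine Polynomial.eq_zero_of_infinite_isRoot _
      ((Set.infinite_range_of_injective (Nat.cast_injective (R := ℂ))).mono ?_)
    rintro _ ⟨n, rfl⟩
    simpa [MvPolynomial.coeff_map] using congrArg (MvPolynomial.coeff m) (hmap n)
  rw [hp0, map_zero] at hp
  exact (IsLocalization.map_units _ t).mul_left_eq_zero.mp hp

theorem Interpolates.unique (hf : f ≠ 0) (H : Interpolates h u) (H' : Interpolates h' u) :
    h = h' := by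
  refine sub_eq_zero.mp (eq_zero_of_evalPow_natCast hf fun n => ?_)
  have hu : IsUnit (algebraMap _ (Localization.Away f) f ^ n) :=
    (IsLocalization.Away.algebraMap_isUnit f).pow n
  rw [map_sub, sub_eq_zero]
  exact hu.mul_right_cancel ((H n).symm.trans (H' n))

end Evaluation

section Lifts

theorem act_ι (v : Fin N ⊕ Fin N) : act f (RingQuot.mkAlgHom ℂ[X] (WeylRel ℂ[X] N)
    (FreeAlgebra.ι ℂ[X] v)) = genAct f v := by
  simp [act]

/-- The operator `W` specializes to `A n` at `s = n`. -/
def Specializes (f : MvPolynomial (Fin N) ℂ) (W : WeylAlgebra ℂ[X] N)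
    (A : ℕ → Module.End ℂ (MvPolynomial (Fin N) ℂ)) : Prop :=
  ∀ (h : PowModule f) u, Interpolates h u → Interpolates (act f W h) (fun n => A n (u n))

theorem specializes_algebraMap (b : ℂ[X]) :
    Specializes f (algebraMap ℂ[X] _ b) (fun n => algebraMap ℂ _ (b.eval (n : ℂ))) :=
  fun h u hu => by simpa only [AlgHom.commutes, Module.algebraMap_end_apply] using hu.smul b

variable (f) in
/-- The sequences of operators on `ℂ[x]` that are specialized from an element of `A^N[s]`. -/
def liftable : Subalgebra ℂ (ℕ → Module.End ℂ (MvPolynomial (Fin N) ℂ)) where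
  carrier := {A | ∃ W, Specializes f W A}
  mul_mem' := by
    rintro A A' ⟨W, hW⟩ ⟨W', hW'⟩
    exact ⟨W * W', fun h u hu => by rw [map_mul]; exact hW _ _ (hW' h u hu)⟩
  add_mem' := by
    rintro A A' ⟨W, hW⟩ ⟨W', hW'⟩
    exact ⟨W + W', fun h u hu => by rw [map_add]; exact (hW h u hu).add (hW' h u hu)⟩
  algebraMap_mem' c := by
    have h := specializes_algebraMap (f := f) (Polynomial.C c)
    simp only [eval_C] at h
    exact ⟨_, h⟩

theorem algebraMap_eval_mem_liftable (b : ℂ[X]) :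
    (fun n : ℕ => algebraMap ℂ _ (b.eval (n : ℂ))) ∈ liftable f :=
  ⟨_, specializes_algebraMap b⟩

theorem mulLeft_X_mem_liftable (i : Fin N) :
    (fun _ => LinearMap.mulLeft ℂ (MvPolynomial.X i)) ∈ liftable f :=
  ⟨_, fun h u hu => by rw [act_ι (.inl i)]; exact hu.xAct i⟩

theorem pderiv_mem_liftable (i : Fin N) :
    (fun _ => (MvPolynomial.pderiv i).toLinearMap) ∈ liftable f :=
  ⟨_, fun h u hu => by rw [act_ι (.inr i)]; exact hu.dAct i⟩

theorem eulerDeriv_mem_liftable : (fun _ => eulerDeriv.toLinearMap) ∈ liftable f := by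
  have h : (fun _ : ℕ => (eulerDeriv (σ := Fin N) (R := ℂ)).toLinearMap) =
      ∑ a, (fun _ => LinearMap.mulLeft ℂ (MvPolynomial.X a)) *
        (fun _ => (MvPolynomial.pderiv a).toLinearMap) := by
    funext n
    refine LinearMap.ext fun p => ?_
    simp [eulerDeriv_apply]
  rw [h]
  exact sum_mem fun a _ => mul_mem (mulLeft_X_mem_liftable a) (pderiv_mem_liftable a)

theorem exists_mem_liftable_dehomogenization (p : MvPolynomial (Option (Fin N)) ℂ) (c : ℂ[X]) :
    ∃ A ∈ liftable f, ∀ (n : ℕ) g, eulerDeriv g = c.eval (n : ℂ) • g →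
      A n (dehomogenization g) = dehomogenization (pderivOp p g) := by
  induction p using MvPolynomial.induction_on generalizing c with
  | C a =>
    refine ⟨_, algebraMap_mem _ a, fun n g _ => ?_⟩
    rw [← MvPolynomial.algebraMap_eq, AlgHom.commutes, Pi.algebraMap_apply,
      Module.algebraMap_end_apply, Module.algebraMap_end_apply, map_smul]
  | add p q hp hq =>
    obtain ⟨A, hA, hAp⟩ := hp c
    obtain ⟨A', hA', hAq⟩ := hq c
    exact ⟨A + A', add_mem hA hA', fun n g hg => by
      simp only [Pi.add_apply, LinearMap.add_apply, map_add, hAp n g hg, hAq n g hg]⟩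
  | mul_X p v hp =>
    rcases v with _ | a
    · obtain ⟨A, hA, hAp⟩ := hp (c - 1)
      refine ⟨A * ((fun n : ℕ => algebraMap ℂ _ (c.eval (n : ℂ))) -
        fun _ => eulerDeriv.toLinearMap), mul_mem hA
          (sub_mem (algebraMap_eval_mem_liftable c) eulerDeriv_mem_liftable), fun n g hg => ?_⟩
      have hg' := eulerDeriv_pderiv_of_eulerDeriv_eq_smul none hg
      rw [← eval_one (x := (n : ℂ)), ← eval_sub] at hg'
      rw [map_mul, Module.End.mul_apply, pderivOp_X, ← hAp n _ hg',
        dehomogenization_pderiv_none hg]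
      rfl
    · obtain ⟨A, hA, hAp⟩ := hp c
      refine ⟨_, mul_mem (pderiv_mem_liftable a) hA, fun n g hg => ?_⟩
      rw [mul_comm, map_mul, Module.End.mul_apply, pderivOp_X, dehomogenization_pderiv_some,
        ← hAp n g hg]
      rfl

theorem mem_functionalIdeal_of_liftable (hf : f ≠ 0) {A : ℕ → Module.End ℂ (MvPolynomial (Fin N) ℂ)}
    (hA : A ∈ liftable f) {b : ℂ[X]}
    (h : ∀ n : ℕ, A n (f ^ (n + 1)) = b.eval (n : ℂ) • f ^ n) :
    b ∈ functionalIdeal f := by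
  obtain ⟨W, hW⟩ := hA
  have hbase : Interpolates (base f) (fun n => f ^ (n + 1)) := fun n => by
    rw [evalPow_base, map_pow, pow_succ']
  have hone : Interpolates (1 : PowModule f) (fun n => f ^ n) := fun n => by
    rw [map_one, map_pow, one_mul]
  have hWbase := hW _ _ hbase
  simp only [h] at hWbase
  exact ⟨W, hWbase.unique hf (hone.smul b)⟩

end Lifts

section Minimal

theorem IsBernsteinSatoPolynomial.functionalIdeal_eq_span {b : ℂ[X]}
    (hb : IsBernsteinSatoPolynomial f b) : functionalIdeal f = Ideal.span {b} := by
  have hmem : b ∈ functionalIdeal f := hb.exists_operator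
  obtain ⟨g, hg, hspan⟩ := exists_monic_span (functionalIdeal f)
    ((Submodule.ne_bot_iff _).mpr ⟨b, hmem, hb.monic.ne_zero⟩)
  have hgb : g ∣ b := Ideal.mem_span_singleton.mp (hspan ▸ hmem)
  have hgmem : g ∈ functionalIdeal f := hspan ▸ Ideal.mem_span_singleton_self g
  rw [hspan, eq_of_monic_of_dvd_of_natDegree_le hg hb.monic hgb (hb.minimal g hg hgmem)]

theorem IsBernsteinSatoPolynomial.dvd {b c : ℂ[X]} (hb : IsBernsteinSatoPolynomial f b)
    (hc : c ∈ functionalIdeal f) : b ∣ c :=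
  Ideal.mem_span_singleton.mp (hb.functionalIdeal_eq_span ▸ hc)

theorem existsUnique_isBernsteinSatoPolynomial {c : ℂ[X]} (hc0 : c ≠ 0)
    (hc : c ∈ functionalIdeal f) : ∃! b, IsBernsteinSatoPolynomial f b := by
  obtain ⟨b, hb, hspan⟩ := exists_monic_span (functionalIdeal f)
    ((Submodule.ne_bot_iff _).mpr ⟨c, hc, hc0⟩)
  have hmem : b ∈ functionalIdeal f := hspan ▸ Ideal.mem_span_singleton_self b
  refine ⟨b, ⟨hb, hmem, fun d hd hP => natDegree_le_of_dvd (Ideal.mem_span_singleton.mp ?_)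
    hd.ne_zero⟩, fun b' hb' => eq_of_monic_of_associated hb'.monic hb
      (Ideal.span_singleton_eq_span_singleton.mp (hb'.functionalIdeal_eq_span.symm.trans hspan))⟩
  exact hspan ▸ (hP : d ∈ functionalIdeal f)

end Minimal

section TrivialFactor

theorem act_mem (M : Submodule ℂ[X] (PowModule f)) (hx : ∀ i, ∀ h ∈ M, xAct f i h ∈ M)
    (hd : ∀ i, ∀ h ∈ M, dAct f i h ∈ M) (P : WeylAlgebra ℂ[X] N) {h : PowModule f} (hh : h ∈ M) :
    act f P h ∈ M := by
  obtain ⟨P, rfl⟩ := RingQuot.mkAlgHom_surjective ℂ[X] (WeylRel ℂ[X] N) P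
  induction P using FreeAlgebra.induction generalizing h with
  | grade0 c =>
    rw [AlgHom.commutes, AlgHom.commutes, Module.algebraMap_end_apply]
    exact M.smul_mem _ hh
  | grade1 v =>
    rw [act_ι]
    rcases v with i | i
    exacts [hx i h hh, hd i h hh]
  | mul P Q hP hQ =>
    rw [map_mul, map_mul]
    exact hP (hQ hh)
  | add P Q hP hQ =>
    rw [map_add, map_add]
    exact M.add_mem (hP hh) (hQ hh)

variable (f) in
/-- The elements of `ℂ[s, x, 1/f]` whose value at `s = -1` is a polynomial multiple of `f`. As
`∂ i` maps `(f * g) · f ^ (-1)` to `∂ g / ∂ x i`, they correspond to a submodule of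
`ℂ[s, x, 1/f] · f ^ s`. -/
noncomputable def multiplesAtNegOne : Submodule ℂ[X] (PowModule f) where
  carrier := {h | ∃ g, evalPow f (-1) h = algebraMap _ _ (f * g)}
  add_mem' := by
    rintro h h' ⟨g, hg⟩ ⟨g', hg'⟩
    exact ⟨g + g', by rw [map_add, hg, hg', mul_add, map_add]⟩
  zero_mem' := ⟨0, by simp⟩
  smul_mem' := by
    rintro c h ⟨g, hg⟩
    refine ⟨c.eval (-1) • g, ?_⟩
    rw [evalPow_smul, hg, mul_smul_comm]
    exact (map_smul (IsScalarTower.toAlgHom ℂ _ (Localization.Away f)) _ _).symm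

theorem dAct_mem_multiplesAtNegOne (i : Fin N) (h : PowModule f) (hh : h ∈ multiplesAtNegOne f) :
    dAct f i h ∈ multiplesAtNegOne f := by
  obtain ⟨g, hg⟩ := hh
  refine ⟨MvPolynomial.pderiv i g,
    (IsLocalization.Away.algebraMap_isUnit (S := Localization.Away f) f).mul_left_cancel ?_⟩
  rw [algebraMap_mul_evalPow_dAct, hg, locDeriv_algebraMap, neg_one_smul]
  simp only [Derivation.leibniz, smul_eq_mul, map_add, map_mul]
  ring

theorem X_add_one_dvd_of_functionalEquation (hf : f ≠ 0) (hf0 : MvPolynomial.eval 0 f = 0)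
    {P : WeylAlgebra ℂ[X] N} {b : ℂ[X]} (hP : FunctionalEquation f P b) : X + 1 ∣ b := by
  have hbase : base f ∈ multiplesAtNegOne f := ⟨1, by rw [evalPow_base, mul_one]⟩
  have hx : ∀ i, ∀ h ∈ multiplesAtNegOne f, xAct f i h ∈ multiplesAtNegOne f :=
    fun i h ⟨g, hg⟩ => ⟨MvPolynomial.X i * g, by
      rw [xAct, LinearMap.mulLeft_apply, map_mul, hg, evalPow_toPow, MvPolynomial.map_X,
        mul_left_comm, map_mul _ (MvPolynomial.X i)]⟩
  obtain ⟨g, hg⟩ := act_mem _ hx dAct_mem_multiplesAtNegOne P hbase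
  rw [hP, evalPow_smul, map_one, ← Algebra.algebraMap_eq_smul_one,
    IsScalarTower.algebraMap_apply ℂ (MvPolynomial (Fin N) ℂ)] at hg
  have hroot := congrArg (MvPolynomial.eval 0) (injective_algebraMap_away hf hg)
  rw [MvPolynomial.algebraMap_eq, MvPolynomial.eval_C, map_mul, hf0, zero_mul] at hroot
  simpa using Polynomial.dvd_iff_isRoot.mpr hroot

end TrivialFactor

end BernsteinSato

theorem det_fromBlocks_map_algebraMap {K S m n : Type*} [CommRing K] [CommRing S] [Algebra K S]
    [Fintype m] [DecidableEq m] [Fintype n] [DecidableEq n] (A : Matrix m m S) (B : Matrix m n S)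
    (C : Matrix n m S) {g : Matrix n n K} (hg : IsUnit g.det) :
    (Matrix.fromBlocks A B C (g.map (algebraMap K S))).det =
      g.det • (A - B * g⁻¹.map (algebraMap K S) * C).det := by
  have hinv : g⁻¹.map (algebraMap K S) * g.map (algebraMap K S) = 1 := by
    rw [← Matrix.map_mul, Matrix.nonsing_inv_mul _ hg]
    simp
  let _ : Invertible (g.map (algebraMap K S)) := ⟨_, hinv, mul_eq_one_comm.mp hinv⟩
  rw [Matrix.det_fromBlocks₂₂, Algebra.smul_def]
  congr 1
  exact ((algebraMap K S).map_det g).symm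

theorem eval_X_add_one_mul_prod_Icc (E L n : ℕ) :
    ((Polynomial.X + 1) * ∏ j ∈ Finset.Icc 2 (L + 1),
        (Polynomial.X + Polynomial.C (((E : ℂ) + (j : ℂ)) / 2))).eval (n : ℂ) =
      (n + 1) * ∏ j ∈ Finset.range L, ((n + 1 : ℕ) + E / 2 + j * (1 / 2) : ℂ) := by
  rw [← Finset.Ico_add_one_right_eq_Icc, Finset.prod_Ico_eq_prod_range, Polynomial.eval_mul,
    Polynomial.eval_prod]
  simp only [Polynomial.eval_add, Polynomial.eval_X, Polynomial.eval_one, Polynomial.eval_C]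
  congr 1
  refine Finset.prod_congr rfl fun j _ => ?_
  push_cast
  ring

namespace IntegralFamily

open MvPolynomial

variable {L E N : ℕ} (F : IntegralFamily L E N)

section Homogeneity

theorem isHomogeneous_loopMatrix (i j : Fin L) : (F.loopMatrix i j).IsHomogeneous 1 :=
  (IsHomogeneous.sum _ _ _ fun _ _ => isHomogeneous_C_mul_X _ _).neg

theorem isHomogeneous_linearPart (i : Fin L) (r : Fin E) : (F.linearPart i r).IsHomogeneous 1 :=
  IsHomogeneous.sum _ _ _ fun _ _ => isHomogeneous_C_mul_X _ _

theorem isHomogeneous_linearGram (i j : Fin L) : (F.linearGram i j).IsHomogeneous 2 := by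
  simp only [linearGram, Matrix.mul_apply, Finset.sum_mul]
  exact IsHomogeneous.sum _ _ _ fun r _ => IsHomogeneous.sum _ _ _ fun s _ =>
    ((F.isHomogeneous_linearPart i s).mul (isHomogeneous_C _ _)).mul
      (F.isHomogeneous_linearPart j r)

theorem isHomogeneous_constPart : F.constPart.IsHomogeneous 1 :=
  IsHomogeneous.sum _ _ _ fun _ _ => isHomogeneous_C_mul_X _ _

theorem isHomogeneous_symanzikU : F.symanzikU.IsHomogeneous L := by
  simpa [symanzikU] using isHomogeneous_det F.isHomogeneous_loopMatrix

theorem isHomogeneous_symanzikF : F.symanzikF.IsHomogeneous (L + 1) := by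
  rw [symanzikF_eq_trace]
  refine IsHomogeneous.add ?_ (F.isHomogeneous_symanzikU.mul F.isHomogeneous_constPart)
  refine IsHomogeneous.sum _ _ _ fun i _ => ?_
  rw [Matrix.diag_apply, Matrix.mul_apply]
  refine IsHomogeneous.sum _ _ _ fun j _ => ?_
  cases L with
  | zero => exact i.elim0
  | succ l =>
    simpa using (isHomogeneous_adjugate F.isHomogeneous_loopMatrix i j).mul
      (F.isHomogeneous_linearGram j i)

theorem isHomogeneous_homLeePomeransky : F.homLeePomeransky.IsHomogeneous (L + 1) := by
  refine IsHomogeneous.add ?_ F.isHomogeneous_symanzikF.rename_isHomogeneous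
  rw [add_comm]
  exact (isHomogeneous_X _ _).mul F.isHomogeneous_symanzikU.rename_isHomogeneous

theorem dehomogenization_homLeePomeransky :
    dehomogenization F.homLeePomeransky = F.leePomeransky := by
  rw [homLeePomeransky, map_add, map_mul, dehomogenization_X_none, dehomogenization_rename_some,
    dehomogenization_rename_some, one_mul, leePomeransky]

variable (B : Matrix (LoopPair L E) (Fin N) ℂ)

theorem isHomogeneous_pairSymbol (t : LoopPair L E) : (F.pairSymbol B t).IsHomogeneous 1 :=
  IsHomogeneous.sum _ _ _ fun _ _ =>
    ((isHomogeneous_X _ _).sub (isHomogeneous_C_mul_X _ _)).C_mul _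

theorem isHomogeneous_heatSymbol (i j : Fin L) : (F.heatSymbol B i j).IsHomogeneous 2 := by
  refine ((isHomogeneous_X _ _).mul (F.isHomogeneous_pairSymbol B _)).sub ?_
  simp only [Matrix.mul_apply, Finset.sum_mul]
  exact IsHomogeneous.sum _ _ _ fun r _ => IsHomogeneous.sum _ _ _ fun s _ =>
    ((F.isHomogeneous_pairSymbol B _).mul (isHomogeneous_C _ _)).mul
      (F.isHomogeneous_pairSymbol B _)

end Homogeneity

section Baikov

variable (B : Matrix (LoopPair L E) (Fin N) ℂ)

/-- If `B` is inverse to the coefficient matrix, the scalar product `t` as a polynomial in the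
denominators. -/
noncomputable def pairPolynomial (t : LoopPair L E) : MvPolynomial (Fin N) ℂ :=
  ∑ a, C (B t a) * (X a - C (F.const a))

theorem dehomogenization_pairSymbol (t : LoopPair L E) :
    dehomogenization (F.pairSymbol B t) = F.pairPolynomial B t := by
  simp [pairSymbol, pairPolynomial, dehomogenization]

theorem totalDegree_pairPolynomial_le (t : LoopPair L E) :
    (F.pairPolynomial B t).totalDegree ≤ 1 := by
  refine totalDegree_finsetSum_le fun a _ => (totalDegree_mul _ _).trans ?_
  rw [totalDegree_C, zero_add]
  exact (totalDegree_sub_C_le _ _).trans (totalDegree_X a).le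

theorem dehomogenization_det_heatSymbol (hg : F.gram.det ≠ 0) :
    dehomogenization (F.gram.det • (F.heatSymbol B).det) =
      ((aeval (F.pairPolynomial B)).mapMatrix F.scalarProduct).det := by
  have hblocks : (aeval (F.pairPolynomial B)).mapMatrix F.scalarProduct = Matrix.fromBlocks
      (.of fun i j => F.pairPolynomial B (.mk i (.inl j)))
      (.of fun i r => F.pairPolynomial B (.mk i (.inr r)))
      (Matrix.of fun i r => F.pairPolynomial B (.mk i (.inr r))).transpose
      (F.gram.map (algebraMap ℂ _)) := by
    ext1 (i | r) (j | s) <;> simp [scalarProduct]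
  rw [hblocks, det_fromBlocks_map_algebraMap _ _ _ (isUnit_iff_ne_zero.mpr hg), map_smul,
    AlgHom.map_det]
  congr 3
  ext1 i j
  simp [heatSymbol, Matrix.mul_apply, dehomogenization_pairSymbol, dehomogenization_X_none]

variable {F B} {P : MvPolynomial (Fin N) ℂ}

theorem aeval_pairPolynomial_denominator (hAB : F.coeff * B = 1) (a : Fin N) :
    aeval (F.pairPolynomial B) (F.denominator a) = X a := by
  have h : ∀ c, ∑ t, F.coeff a t * B t c = if a = c then 1 else 0 := fun c => by
    rw [← Matrix.mul_apply, hAB, Matrix.one_apply]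
  have hsum : ∑ t, C (F.coeff a t) * F.pairPolynomial B t = X a - C (F.const a) := by
    simp only [pairPolynomial, Finset.mul_sum]
    rw [Finset.sum_comm]
    simp only [← mul_assoc, ← C_mul, ← Finset.sum_mul, ← map_sum, h]
    simp
  simp only [denominator, map_add, map_sum, map_mul, algHom_C, algebraMap_eq, aeval_X, hsum,
    sub_add_cancel]

theorem IsBaikovPolynomial.eq_det (hAB : F.coeff * B = 1) (hP : F.IsBaikovPolynomial P) :
    P = ((aeval (F.pairPolynomial B)).mapMatrix F.scalarProduct).det := by
  rw [← AlgHom.map_det, ← hP, comp_aeval_apply]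
  simp only [aeval_pairPolynomial_denominator hAB]
  exact (aeval_X_left_apply P).symm

theorem IsBaikovPolynomial.totalDegree_le (hAB : F.coeff * B = 1) (hP : F.IsBaikovPolynomial P)
    (hEL : E = 1 ∨ L = 1) : P.totalDegree ≤ L + 1 := by
  have hX (t : LoopPair _ _) :
      (aeval (F.pairPolynomial B) (X t : MvPolynomial _ ℂ)).totalDegree ≤ 1 := by
    rw [aeval_X]
    exact F.totalDegree_pairPolynomial_le B t
  have hC (c : ℂ) : (aeval (F.pairPolynomial B) (C c)).totalDegree = 0 := by
    rw [algHom_C]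
    exact totalDegree_C c
  rw [hP.eq_det hAB]
  rcases hEL with rfl | rfl
  · refine (totalDegree_det_le (fun _ => 1) (fun _ => 0) ?_).trans (by simp)
    rintro (i | r) (j | s)
    exacts [hX _, hX _, hX _, (hC _).le.trans (Nat.zero_le _)]
  · refine (totalDegree_det_le (Sum.elim (fun _ => 1) fun _ => 0)
      (Sum.elim (fun _ => 1) fun _ => 0) ?_).trans (by simp)
    rintro (i | r) (j | s)
    exacts [(hX _).trans one_le_two, hX _, hX _, (hC _).le]

theorem IsBaikovPolynomial.X_none_pow_mul_homogenization (hAB : F.coeff * B = 1)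
    (hg : F.gram.det ≠ 0) (hP : F.IsBaikovPolynomial P) (hdeg : P.totalDegree ≤ L + 1) :
    X none ^ L * homogenization (L + 1) P = X none * (F.gram.det • (F.heatSymbol B).det) := by
  have hdehom : dehomogenization (X none * (F.gram.det • (F.heatSymbol B).det)) = P := by
    rw [map_mul, dehomogenization_X_none, one_mul, F.dehomogenization_det_heatSymbol B hg,
      ← hP.eq_det hAB]
  have hhom : (X none * (F.gram.det • (F.heatSymbol B).det)).IsHomogeneous (L + (L + 1)) := by
    have h := (isHomogeneous_X ℂ none).mul
      ((isHomogeneous_det (F.isHomogeneous_heatSymbol B)).C_mul F.gram.det)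
    rw [← smul_eq_C_mul, Fintype.card_fin] at h
    convert h using 1
    ring
  have h := X_none_pow_mul_homogenization_dehomogenization hhom (hdehom.symm ▸ hdeg)
  rwa [hdehom] at h

end Baikov

section Nonvanishing

variable {F} {B : Matrix (LoopPair L E) (Fin N) ℂ}

theorem symanzikU_ne_zero (hBA : B * F.coeff = 1) : F.symanzikU ≠ 0 := by
  classical
  -- The point `x` is chosen such that `Λ = 1` there.
  let v : LoopPair L E → ℂ := fun t => if ∃ i, t = .mk i (.inl i) then -1 else 0
  have hv (t) : ∑ a, F.coeff a t * Matrix.vecMul v B a = v t := by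
    have h : Matrix.vecMul (Matrix.vecMul v B) F.coeff t = v t := by
      rw [Matrix.vecMul_vecMul, hBA, Matrix.vecMul_one]
    rw [← h]
    exact Finset.sum_congr rfl fun a _ => mul_comm _ _
  have hΛ : (eval (Matrix.vecMul v B)).mapMatrix F.loopMatrix = 1 := by
    ext i j
    rw [RingHom.mapMatrix_apply, Matrix.map_apply, loopMatrix, map_neg, map_sum, Matrix.one_apply]
    simp only [map_mul, eval_C, eval_X, mul_assoc, ← Finset.mul_sum, hv]
    by_cases hij : i = j
    · subst hij
      have h : ∃ k, (LoopPair.mk i (.inl i) : LoopPair L E) = .mk k (.inl k) := ⟨i, rfl⟩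
      simp [v, h]
    · have h : ¬∃ k, (LoopPair.mk i (.inl j) : LoopPair L E) = .mk k (.inl k) := by
        rintro ⟨k, hk⟩
        rcases (LoopPair.mk_inl_eq_mk_inl _ _ _ _).mp hk with ⟨rfl, rfl⟩ | ⟨rfl, rfl⟩ <;>
          exact hij rfl
      simp [v, hij, h]
  intro hU
  have h := congrArg (eval (Matrix.vecMul v B)) hU
  rw [symanzikU, RingHom.map_det, hΛ, Matrix.det_one, map_zero] at h
  exact one_ne_zero h

theorem leePomeransky_ne_zero (hU : F.symanzikU ≠ 0) : F.leePomeransky ≠ 0 := by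
  intro h
  have hL := congrArg (homogeneousComponent L) h
  rw [leePomeransky, map_add, homogeneousComponent_of_mem F.isHomogeneous_symanzikU, if_pos rfl,
    homogeneousComponent_of_mem F.isHomogeneous_symanzikF, if_neg (Nat.succ_ne_self L).symm,
    add_zero, map_zero] at hL
  exact hU hL

variable (F) in
theorem eval_zero_leePomeransky (hL : L ≠ 0) : eval 0 F.leePomeransky = 0 := by
  rw [eval_zero, constantCoeff_eq, leePomeransky, coeff_add,
    F.isHomogeneous_symanzikU.coeff_eq_zero (by simpa using hL.symm),
    F.isHomogeneous_symanzikF.coeff_eq_zero (by simp), add_zero]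

end Nonvanishing

variable {F}

theorem IsBaikovPolynomial.mem_functionalIdeal {P : MvPolynomial (Fin N) ℂ} (hA : F.IsComplete)
    (hg : F.gram.det ≠ 0) (hP : F.IsBaikovPolynomial P) (hdeg : P.totalDegree ≤ L + 1) :
    (Polynomial.X + 1) * ∏ j ∈ Finset.Icc 2 (L + 1),
        (Polynomial.X + Polynomial.C (((E : ℂ) + (j : ℂ)) / 2)) ∈
      BernsteinSato.functionalIdeal F.leePomeransky := by
  obtain ⟨B, hAB, hBA⟩ := hA
  have hU := symanzikU_ne_zero hBA
  obtain ⟨A, hA, hdehom⟩ := BernsteinSato.exists_mem_liftable_dehomogenization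
    (f := F.leePomeransky) (homogenization (L + 1) P)
    (Polynomial.C (L + 1 : ℂ) * (Polynomial.X + 1))
  have hunit : IsUnit (Polynomial.C (F.gram.det * (-1) ^ L)) :=
    Polynomial.isUnit_C.mpr (isUnit_iff_ne_zero.mpr (by simp [hg]))
  refine (Ideal.unit_mul_mem_iff_mem _ hunit).mp (BernsteinSato.mem_functionalIdeal_of_liftable
    (leePomeransky_ne_zero hU) hA fun n => ?_)
  have heuler := eulerDeriv_of_isHomogeneous (F.isHomogeneous_homLeePomeransky.pow (n + 1))
  rw [← dehomogenization_homLeePomeransky, ← map_pow, hdehom n _ (heuler.trans (by simp)),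
    pderivOp_homLeePomeransky_pow hBA hg hU (hP.X_none_pow_mul_homogenization hAB hg hdeg),
    map_smul, map_pow, Polynomial.eval_mul, Polynomial.eval_C, eval_X_add_one_mul_prod_Icc]

end IntegralFamily

theorem roots_prod_X_add_C {R ι : Type*} [CommRing R] [IsDomain R] (s : Finset ι) (a : ι → R) :
    (∏ i ∈ s, (Polynomial.X + Polynomial.C (a i))).roots = s.val.map fun i => -a i := by
  rw [← Polynomial.roots_multiset_prod_X_sub_C (s.val.map fun i => -a i)]
  simp only [Multiset.map_map, Function.comp_apply, Polynomial.C_neg, sub_neg_eq_add,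
    Finset.prod_map_val]

theorem nodup_roots_and_exists_eq_div_two_of_dvd {E : ℕ} {s : Finset ℕ} {c : Polynomial ℂ}
    (hc : c ∣ ∏ j ∈ s, (Polynomial.X + Polynomial.C (((E : ℂ) + (j : ℂ)) / 2))) :
    c.roots.Nodup ∧ ∀ z ∈ c.roots, ∃ k : ℤ, z = (k : ℂ) / 2 := by
  have hroots := Polynomial.roots.le_of_dvd
    (Finset.prod_ne_zero_iff.mpr fun j _ => Polynomial.X_add_C_ne_zero _) hc
  rw [roots_prod_X_add_C] at hroots
  refine ⟨Multiset.nodup_of_le hroots (s.nodup.map fun i j hij => ?_), fun z hz => ?_⟩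
  · simpa using hij
  · obtain ⟨j, -, rfl⟩ := Multiset.mem_map.mp (Multiset.mem_of_le hroots hz)
    exact ⟨-(E + j), by push_cast; ring⟩

theorem mainTheorem12 {L E N : ℕ} (hL : 1 ≤ L) (F : IntegralFamily L E N)
    (hA : F.IsComplete) (hGr : F.gram.det ≠ 0)
    (P : MvPolynomial (Fin N) ℂ) (hP : F.IsBaikovPolynomial P) :
    (P.totalDegree ≤ L + 1 →
      (∃! b : Polynomial ℂ, BernsteinSato.IsBernsteinSatoPolynomial F.leePomeransky b) ∧
      ∀ b : Polynomial ℂ, BernsteinSato.IsBernsteinSatoPolynomial F.leePomeransky b →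
        b ∣ (Polynomial.X + 1) * ∏ j ∈ Finset.Icc 2 (L + 1),
          (Polynomial.X + Polynomial.C (((E : ℂ) + (j : ℂ)) / 2)) ∧
        ∃ c : Polynomial ℂ, b = (Polynomial.X + 1) * c ∧ c.roots.Nodup ∧
          ∀ z ∈ c.roots, ∃ k : ℤ, z = (k : ℂ) / 2) ∧
    (E = 1 ∨ L = 1 → P.totalDegree ≤ L + 1) := by
  have ⟨B, hAB, hBA⟩ := hA
  refine ⟨fun hdeg => ?_, hP.totalDegree_le hAB⟩
  have hmem := hP.mem_functionalIdeal hA hGr hdeg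
  have hX : (Polynomial.X + 1 : Polynomial ℂ) ≠ 0 := Polynomial.X_add_C_ne_zero 1
  have hprod := Finset.prod_ne_zero_iff.mpr fun (j : ℕ) (_ : j ∈ Finset.Icc 2 (L + 1)) =>
    Polynomial.X_add_C_ne_zero (((E : ℂ) + (j : ℂ)) / 2)
  refine ⟨BernsteinSato.existsUnique_isBernsteinSatoPolynomial (mul_ne_zero hX hprod) hmem,
    fun b hb => ?_⟩
  have hdvd := hb.dvd hmem
  obtain ⟨Q, hQ⟩ := hb.exists_operator
  obtain ⟨c, rfl⟩ := BernsteinSato.X_add_one_dvd_of_functionalEquation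
    (IntegralFamily.leePomeransky_ne_zero (IntegralFamily.symanzikU_ne_zero hBA))
    (F.eval_zero_leePomeransky (Nat.one_le_iff_ne_zero.mp hL)) hQ
  exact ⟨hdvd, c, rfl,
    nodup_roots_and_exists_eq_div_two_of_dvd ((mul_dvd_mul_iff_left hX).mp hdvd)⟩
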